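/- An edge-ordered graph is a finite simple graph together with a linear order on its edge set. An edge-ordered graph $G$ contains an edge-ordered graph $H$ if $H$ is isomorphic, by an isomorphism respecting the edge-orders, to a subgraph of $G$ with the inherited edge-order; otherwise $G$ avoids $H$. For an edge-ordered graph $H$ with at least one edge, $\mathrm{ex}_<(n,H)$ denotes the maximal number of edges in an edge-ordered graph on $n$ vertices that avoids $H$. An edge-ordered path is an edge-ordered graph whose underlying simple graph is a path. A path with $k$ edges is described by listing the labels $1,\dots,k$ of its edges along the path, where an edge precedes another in the edge-order if its label is smaller. The path is monotone if the labels increase monotonically or decrease monotonically along the path. It is flipped if $k\ge 3$ and it is obtained from a monotone path by switching either the two smallest or the two largest labels. Let $P$ be an edge-ordered path with at least two edges. 1. If $P$ is monotone or flipped, then $\mathrm{ex}_<(n,P)=\Theta(n)$ as $n\to\infty$. 2. In all other cases, $\mathrm{ex}_<(n,P)=\Omega(n\log n)$ as $n\to\infty$. -/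

import Mathlib

open Filter Asymptotics

/-- An edge-ordered graph: a simple graph together with a linear order on its edge set. -/
structure EdgeOrderedGraph (V : Type*) where
  graph : SimpleGraph V
  order : LinearOrder graph.edgeSet

namespace EdgeOrderedGraph

/-- `e` precedes `f` in the edge-order of `G`. -/
def EdgeLT {V : Type*} (G : EdgeOrderedGraph V) (e f : G.graph.edgeSet) : Prop :=
  G.order.lt e f

/-- `G` contains `H`: there is a copy of the simple graph underlying `H` in the simple graph
underlying `G` (that is, an isomorphism of it onto a subgraph) that respects the edge-orders. -/
def Contains {V W : Type*} (G : EdgeOrderedGraph V) (H : EdgeOrderedGraph W) : Prop :=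
  ∃ f : SimpleGraph.Copy H.graph G.graph,
    ∀ e e' : H.graph.edgeSet,
      H.EdgeLT e e' ↔ G.EdgeLT (f.mapEdgeSet e) (f.mapEdgeSet e')

/-- `G` avoids `H`. -/
def Avoids {V W : Type*} (G : EdgeOrderedGraph V) (H : EdgeOrderedGraph W) : Prop :=
  ¬ G.Contains H

/-- The extremal function of `H` at `n`: the maximal number of edges in an edge-ordered graph on
`n` vertices that avoids `H`. See `isGreatest_extremalFunction`: the supremum is a maximum as soon
as `H` has an edge. -/
noncomputable def extremalFunction {W : Type*} (H : EdgeOrderedGraph W) (n : ℕ) : ℕ :=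
  sSup {m | ∃ G : EdgeOrderedGraph (Fin n), G.Avoids H ∧ G.graph.edgeSet.ncard = m}

theorem isGreatest_extremalFunction {W : Type*} (H : EdgeOrderedGraph W)
    (hH : H.graph.edgeSet.Nonempty) (n : ℕ) :
    IsGreatest {m | ∃ G : EdgeOrderedGraph (Fin n), G.Avoids H ∧ G.graph.edgeSet.ncard = m}
      (H.extremalFunction n) := by
  have hb : BddAbove
      {m | ∃ G : EdgeOrderedGraph (Fin n), G.Avoids H ∧ G.graph.edgeSet.ncard = m} := by
    refine ⟨Nat.card (Sym2 (Fin n)), ?_⟩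
    rintro m ⟨G, -, rfl⟩
    exact Set.ncard_le_card _
  refine ⟨Nat.sSup_mem ?_ hb, fun m hm => le_csSup hb hm⟩
  have : IsEmpty (⊥ : SimpleGraph (Fin n)).edgeSet := by
    simp
  refine ⟨_, ⟨⟨⊥, LinearOrder.lift' (fun e => (isEmptyElim e : ℕ))
    (fun e => isEmptyElim e)⟩, ?_, rfl⟩⟩
  rintro ⟨f, -⟩
  exact isEmptyElim (f.mapEdgeSet ⟨hH.some, hH.some_mem⟩)

/-- `P` is an edge-ordered path with `k` edges: its underlying simple graph is a path on `k + 1`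
vertices. -/
def IsPath {V : Type*} (P : EdgeOrderedGraph V) (k : ℕ) : Prop :=
  Nonempty (SimpleGraph.pathGraph (k + 1) ≃g P.graph)

/-- The `i`-th edge (`i = 0, …, k - 1`) of the `k`-edge path `P` when it is traversed according
to `φ`. -/
def pathEdge {V : Type*} {P : EdgeOrderedGraph V} {k : ℕ}
    (φ : SimpleGraph.pathGraph (k + 1) ≃g P.graph) (i : Fin k) : P.graph.edgeSet :=
  ⟨s(φ i.castSucc, φ i.succ), by
    rw [SimpleGraph.mem_edgeSet, φ.map_adj_iff, SimpleGraph.pathGraph_adj]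
    simp⟩

/-- `P` is the `k`-edge path whose edges, listed along the path (starting at one of its ends),
carry the labels `σ 0, σ 1, …, σ (k - 1)`. The labels are `0, …, k - 1`. -/
def IsPathLabeled {V : Type*} (P : EdgeOrderedGraph V) {k : ℕ} (σ : Equiv.Perm (Fin k)) : Prop :=
  ∃ φ : SimpleGraph.pathGraph (k + 1) ≃g P.graph,
    ∀ i j : Fin k, P.EdgeLT (pathEdge φ i) (pathEdge φ j) ↔ σ i < σ j

/-- `P` is a monotone path with `k` edges: the labels increase or decrease along the path. -/
def IsMonotonePath {V : Type*} (P : EdgeOrderedGraph V) (k : ℕ) : Prop :=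
  ∃ σ : Equiv.Perm (Fin k), (StrictMono σ ∨ StrictAnti σ) ∧ P.IsPathLabeled σ

/-- `P` is a flipped path with `k` edges: `k ≥ 3`, and the labels are obtained from those of a
monotone path by switching either the two smallest labels or the two largest ones. -/
def IsFlippedPath {V : Type*} (P : EdgeOrderedGraph V) (k : ℕ) : Prop :=
  ∃ _ : 3 ≤ k, ∃ σ : Equiv.Perm (Fin k), (StrictMono σ ∨ StrictAnti σ) ∧
    (P.IsPathLabeled (Equiv.swap ⟨0, by omega⟩ ⟨1, by omega⟩ * σ) ∨
      P.IsPathLabeled (Equiv.swap ⟨k - 2, by omega⟩ ⟨k - 1, by omega⟩ * σ))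

end EdgeOrderedGraph

/-!
Everything is expressed through keys: a function on pairs of vertices whose values at the edges
compare like the edges do (`IsKey`). A copy of a labeled path is then a path `p 0, …, p k` of the
host graph whose keys compare like the labels (`contains_of_path`, `exists_path_of_contains`).

Upper bounds. Fix at every vertex `u` an increasing path with `j` edges ending there whose last edge
`g u` is smallest. If `v u` is the last edge of some increasing path with `j` edges, then the edge
`u v` is not below `g u`, so it extends the path fixed at `u` unless `v` lies on that path. Hence
all but linearly many directed edges end an increasing path with `j` edges, for every `j`
(`card_not_isLastDart_le`), which settles monotone paths. For a path whose two largest labels are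
switched, all but linearly many edges `u v` have many edges at `u` between `g u` and `u v` and many
edges at `v` between `g v` and `u v`. If `g u ≤ g v`, then the path fixed at `u`, the edge `u v` and
one of these edges at `v` form the desired path (`exists_flipped_path`). Reversing the edge-order
gives the paths whose two smallest labels are switched. A matching gives the linear lower bound.

The `n log n` lower bound. The host graph joins `a < N` to `b = a + N + 2 ^ e`, where `N` is about
`n / 4`. It carries five orders: by `±a`, with ties broken by `±b`, and by `a + b`. What makes them
restrictive is that of two edges of different lengths (counted without `N`) at a common vertex, one
is at least twice as long as the other (`PowStep.two_mul_le`). A path contained in the host graph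
for each of the five orders has, among any four consecutive edges, the first two both below or both
above the last two (`separated_of_isPowPath`). After a reversal this orders all labels increasingly,
except possibly the two at either end (`lt_of_separated`). A path in which both end pairs are
switched is excluded by a parity argument (`not_flipped_twice`). What remains are exactly the
monotone and the flipped paths.
-/

namespace EdgeOrderedGraph

/-! ### Keys and copies of labeled paths -/

/-- `r` represents the edge-order of `G`: an edge precedes another one iff it has a smaller value
under `r`. The values of `r` at the pairs that are not edges of `G` are irrelevant. -/
def IsKey {V κ : Type*} [LT κ] (G : EdgeOrderedGraph V) (r : Sym2 V → κ) : Prop :=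
  ∀ e f : G.graph.edgeSet, G.EdgeLT e f ↔ r e < r f

theorem exists_strictMono_int (α : Type*) [LinearOrder α] [Finite α] :
    ∃ f : α → ℤ, StrictMono f := by
  have := Fintype.ofFinite α
  refine ⟨fun a => ((Finset.univ.filter fun b => b < a).card : ℤ), fun a b hab =>
    Nat.cast_lt.2 (Finset.card_lt_card ⟨fun c hc => ?_, fun hsub => ?_⟩)⟩
  · simp only [Finset.mem_filter, Finset.mem_univ, true_and] at hc ⊢
    exact hc.trans hab
  · simpa using hsub (Finset.mem_filter.2 ⟨Finset.mem_univ a, hab⟩)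

theorem exists_isKey {V : Type*} [Finite V] (G : EdgeOrderedGraph V) :
    ∃ r : Sym2 V → ℤ, G.IsKey r := by
  classical
  obtain ⟨f, hf⟩ := @exists_strictMono_int G.graph.edgeSet G.order _
  refine ⟨fun e => if he : e ∈ G.graph.edgeSet then f ⟨e, he⟩ else 0, fun e e' => ?_⟩
  simp only [e.2, e'.2, dif_pos]
  exact (@StrictMono.lt_iff_lt _ _ G.order _ f hf e e').symm

theorem IsKey.injOn {V κ : Type*} [Preorder κ] {G : EdgeOrderedGraph V} {r : Sym2 V → κ}
    (hr : G.IsKey r) : Set.InjOn r G.graph.edgeSet := by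
  intro e he f hf hef
  by_contra hne
  rcases @lt_or_gt_of_ne _ G.order ⟨e, he⟩ ⟨f, hf⟩ (fun h => hne (congrArg Subtype.val h))
    with h | h
  · exact ((hr _ _).1 h).ne hef
  · exact ((hr _ _).1 h).ne' hef

theorem exists_pathEdge_eq {V : Type*} {P : EdgeOrderedGraph V} {k : ℕ}
    (φ : SimpleGraph.pathGraph (k + 1) ≃g P.graph) (e : P.graph.edgeSet) :
    ∃ i, pathEdge φ i = e := by
  obtain ⟨e, he⟩ := e
  induction e using Sym2.ind with
  | _ u v =>
    obtain ⟨a, rfl⟩ := φ.surjective u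
    obtain ⟨b, rfl⟩ := φ.surjective v
    have hab : (SimpleGraph.pathGraph (k + 1)).Adj a b := by
      rw [SimpleGraph.mem_edgeSet, φ.map_adj_iff] at he
      exact he
    rw [SimpleGraph.pathGraph_adj] at hab
    rcases hab with h | h
    · refine ⟨⟨a, by omega⟩, Subtype.ext ?_⟩
      have h1 : (⟨a, by omega⟩ : Fin k).castSucc = a := rfl
      have h2 : (⟨a, by omega⟩ : Fin k).succ = b := Fin.ext h
      simp only [pathEdge, h1, h2]
    · refine ⟨⟨b, by omega⟩, Subtype.ext ?_⟩
      have h1 : (⟨b, by omega⟩ : Fin k).castSucc = b := rfl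
      have h2 : (⟨b, by omega⟩ : Fin k).succ = a := Fin.ext h
      simp only [pathEdge, h1, h2, Sym2.eq_swap]

theorem pathEdge_injective {V : Type*} {P : EdgeOrderedGraph V} {k : ℕ}
    (φ : SimpleGraph.pathGraph (k + 1) ≃g P.graph) : Function.Injective (pathEdge φ) := by
  intro i j hij
  have h := congrArg Subtype.val hij
  simp only [pathEdge, Sym2.eq_iff, φ.injective.eq_iff] at h
  simp only [Fin.ext_iff, Fin.val_castSucc, Fin.val_succ] at h ⊢
  omega

/-- A path `p 0, p 1, …, p k` of `G` whose edges are ordered like the labels `x 0, …, x (k - 1)`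
of the path `P` is a copy of `P`. -/
theorem contains_of_path {V W ι κ : Type*} [LT ι] [LT κ] {P : EdgeOrderedGraph V}
    {G : EdgeOrderedGraph W} {k : ℕ} (φ : SimpleGraph.pathGraph (k + 1) ≃g P.graph) {x : ℕ → ι}
    (hx : ∀ i j : Fin k, P.EdgeLT (pathEdge φ i) (pathEdge φ j) ↔ x i < x j)
    {r : Sym2 W → κ} (hr : G.IsKey r) {p : ℕ → W} (hinj : Set.InjOn p (Set.Iic k))
    (hadj : ∀ i < k, G.graph.Adj (p i) (p (i + 1)))
    (hlt : ∀ i < k, ∀ j < k, r s(p i, p (i + 1)) < r s(p j, p (j + 1)) ↔ x i < x j) :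
    G.Contains P := by
  have hmap : ∀ {u v}, P.graph.Adj u v → G.graph.Adj (p (φ.symm u)) (p (φ.symm v)) := by
    intro u v huv
    have h := φ.symm.map_adj_iff.2 huv
    rw [SimpleGraph.pathGraph_adj] at h
    rcases h with h | h
    · rw [← h]; exact hadj _ (by omega)
    · rw [← h]; exact (hadj _ (by omega)).symm
  let f : SimpleGraph.Copy P.graph G.graph :=
    ⟨⟨fun v => p (φ.symm v), hmap⟩, fun u v huv => φ.symm.injective <| Fin.ext <|
      hinj (Set.mem_Iic.2 (by omega)) (Set.mem_Iic.2 (by omega)) huv⟩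
  have hf : ∀ i : Fin k, ((f.mapEdgeSet (pathEdge φ i) : G.graph.edgeSet) : Sym2 W) =
      s(p i, p (i + 1)) := by
    intro i
    change s(p (φ.symm (φ i.castSucc)), p (φ.symm (φ i.succ))) = _
    simp
  refine ⟨f, fun e e' => ?_⟩
  obtain ⟨i, rfl⟩ := exists_pathEdge_eq φ e
  obtain ⟨j, rfl⟩ := exists_pathEdge_eq φ e'
  rw [hx, hr, hf, hf, hlt i i.2 j j.2]

theorem exists_path_of_contains {V W ι κ : Type*} [LT ι] [LT κ] {P : EdgeOrderedGraph V}
    {G : EdgeOrderedGraph W} {k : ℕ} (φ : SimpleGraph.pathGraph (k + 1) ≃g P.graph) {x : ℕ → ι}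
    (hx : ∀ i j : Fin k, P.EdgeLT (pathEdge φ i) (pathEdge φ j) ↔ x i < x j)
    {r : Sym2 W → κ} (hr : G.IsKey r) (h : G.Contains P) :
    ∃ p : ℕ → W, Set.InjOn p (Set.Iic k) ∧ (∀ i < k, G.graph.Adj (p i) (p (i + 1))) ∧
      ∀ i < k, ∀ j < k, r s(p i, p (i + 1)) < r s(p j, p (j + 1)) ↔ x i < x j := by
  obtain ⟨f, hf⟩ := h
  have hp : ∀ i : Fin k, (f.mapEdgeSet (pathEdge φ i) : Sym2 W) =
      s(f (φ ⟨min i k, by omega⟩), f (φ ⟨min (i + 1) k, by omega⟩)) := by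
    intro i
    change s(f (φ i.castSucc), f (φ i.succ)) = _
    congr 4 <;> ext <;> simp
  refine ⟨fun i => f (φ ⟨min i k, by omega⟩), fun i hi j hj hij => ?_, fun i hi => ?_,
    fun i hi j hj => ?_⟩
  · have := φ.injective (f.injective hij)
    simp only [Set.mem_Iic, Fin.mk.injEq] at hi hj this
    omega
  · refine f.toHom.map_adj (φ.map_adj_iff.2 ?_)
    rw [SimpleGraph.pathGraph_adj]
    simp only
    omega
  · have := hf (pathEdge φ ⟨i, hi⟩) (pathEdge φ ⟨j, hj⟩)
    rw [hx, hr, hp, hp] at this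
    exact this.symm

theorem ncard_edgeSet_le_extremalFunction {V : Type*} {P : EdgeOrderedGraph V} {n : ℕ}
    (hP : P.graph.edgeSet.Nonempty) {G : EdgeOrderedGraph (Fin n)} (hG : G.Avoids P) :
    G.graph.edgeSet.ncard ≤ P.extremalFunction n :=
  (P.isGreatest_extremalFunction hP n).2 ⟨G, hG, rfl⟩

/-- The edge-ordered graph on the simple graph `G` whose edge-order is the one given by the values
of `r` at the edges. -/
def ofKey {V κ : Type*} [LinearOrder κ] (G : SimpleGraph V) (r : Sym2 V → κ)
    (hr : Set.InjOn r G.edgeSet) : EdgeOrderedGraph V where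
  graph := G
  order := LinearOrder.lift' (fun e : G.edgeSet => r e) fun e f h => Subtype.ext (hr e.2 f.2 h)

theorem isKey_ofKey {V κ : Type*} [LinearOrder κ] (G : SimpleGraph V) (r : Sym2 V → κ)
    (hr : Set.InjOn r G.edgeSet) : (ofKey G r hr).IsKey r := fun _ _ => Iff.rfl

/-! ### Labelings of a path and its reversal -/

/-- The path traversed from its other end. -/
def reverseIso {V : Type*} {P : EdgeOrderedGraph V} {k : ℕ}
    (φ : SimpleGraph.pathGraph (k + 1) ≃g P.graph) : SimpleGraph.pathGraph (k + 1) ≃g P.graph :=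
  RelIso.trans (⟨Fin.revPerm, by
    intro a b
    simp only [SimpleGraph.pathGraph_adj, Fin.revPerm_apply, Fin.val_rev]
    omega⟩ : SimpleGraph.pathGraph (k + 1) ≃g SimpleGraph.pathGraph (k + 1)) φ

theorem pathEdge_reverseIso {V : Type*} {P : EdgeOrderedGraph V} {k : ℕ}
    (φ : SimpleGraph.pathGraph (k + 1) ≃g P.graph) (i : Fin k) :
    pathEdge (reverseIso φ) i = pathEdge φ i.rev := by
  apply Subtype.ext
  change s(φ (Fin.rev i.castSucc), φ (Fin.rev i.succ)) = s(φ i.rev.castSucc, φ i.rev.succ)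
  rw [Fin.rev_castSucc, Fin.rev_succ, Sym2.eq_swap]

theorem IsPathLabeled.mul_revPerm {V : Type*} {P : EdgeOrderedGraph V} {k : ℕ}
    {σ : Equiv.Perm (Fin k)} (h : P.IsPathLabeled σ) : P.IsPathLabeled (σ * Fin.revPerm) := by
  obtain ⟨φ, hφ⟩ := h
  refine ⟨reverseIso φ, fun i j => ?_⟩
  rw [pathEdge_reverseIso, pathEdge_reverseIso, hφ]
  rfl

theorem perm_eq_one_of_strictMono {k : ℕ} {σ : Equiv.Perm (Fin k)} (h : StrictMono σ) : σ = 1 := by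
  have := Subsingleton.elim (StrictMono.orderIsoOfSurjective σ h σ.surjective) (OrderIso.refl _)
  ext i
  exact congrArg Fin.val (congrArg (fun f : Fin k ≃o Fin k => f i) this)

/-- If `P` is labeled by a relabeling `τ` of a monotone labeling, then it is labeled by `τ`
itself from a suitable end. -/
theorem isPathLabeled_of_mul_monotone {V : Type*} {P : EdgeOrderedGraph V} {k : ℕ}
    {τ σ : Equiv.Perm (Fin k)} (hσ : StrictMono σ ∨ StrictAnti σ) (h : P.IsPathLabeled (τ * σ)) :
    P.IsPathLabeled τ := by
  rcases hσ with hσ | hσ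
  · rwa [perm_eq_one_of_strictMono hσ, mul_one] at h
  · have h1 : StrictMono (σ * Fin.revPerm : Equiv.Perm (Fin k)) := fun i j hij =>
      hσ (Fin.rev_lt_rev.2 hij)
    have h2 := h.mul_revPerm
    rwa [mul_assoc, perm_eq_one_of_strictMono h1, mul_one] at h2

/-! ### Linear upper bounds: increasing paths -/

theorem strictMonoOn_Iio_of_lt_succ {f : ℕ → ℤ} {k : ℕ} (h : ∀ i, i + 1 < k → f i < f (i + 1)) :
    StrictMonoOn f (Set.Iio k) := by
  have key : ∀ d i, i + (d + 1) < k → f i < f (i + (d + 1)) := by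
    intro d
    induction d with
    | zero => exact fun i hi => h i hi
    | succ d ih => exact fun i hi => (ih i (by omega)).trans (h (i + (d + 1)) hi)
  intro i _ j hj hij
  have := key (j - i - 1) i (by simp only [Set.mem_Iio] at hj; omega)
  rwa [show i + (j - i - 1 + 1) = j by omega] at this

/-- The vertices `p 0, …, p j` form a path of `G` along which `r` increases. -/
def IsIncPath {V : Type*} (G : SimpleGraph V) (r : Sym2 V → ℤ) (j : ℕ) (p : ℕ → V) : Prop :=
  Set.InjOn p (Set.Iic j) ∧ (∀ i < j, G.Adj (p i) (p (i + 1))) ∧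
    ∀ i, i + 1 < j → r s(p i, p (i + 1)) < r s(p (i + 1), p (i + 2))

/-- Some increasing path with `j + 1` edges has `u v` as its last edge, traversed from `u`
to `v`. -/
def IsLastDart {V : Type*} (G : SimpleGraph V) (r : Sym2 V → ℤ) (j : ℕ) (u v : V) : Prop :=
  ∃ p, IsIncPath G r (j + 1) p ∧ p j = u ∧ p (j + 1) = v

theorem injOn_update {V : Type*} {j : ℕ} {p : ℕ → V} (hp : Set.InjOn p (Set.Iic j)) {v : V}
    (hv : ∀ i ≤ j, p i ≠ v) : Set.InjOn (Function.update p (j + 1) v) (Set.Iic (j + 1)) := by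
  intro a ha b hb hab
  simp only [Set.mem_Iic] at ha hb
  by_cases ha' : a = j + 1 <;> by_cases hb' : b = j + 1
  · omega
  · subst ha'
    rw [Function.update_self, Function.update_of_ne hb'] at hab
    exact absurd hab.symm (hv b (by omega))
  · subst hb'
    rw [Function.update_self, Function.update_of_ne ha'] at hab
    exact absurd hab (hv a (by omega))
  · rw [Function.update_of_ne ha', Function.update_of_ne hb'] at hab
    exact hp (Set.mem_Iic.2 (by omega)) (Set.mem_Iic.2 (by omega)) hab

theorem adj_update {V : Type*} {G : SimpleGraph V} {j : ℕ} {p : ℕ → V}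
    (hp : ∀ i < j, G.Adj (p i) (p (i + 1))) {v : V} (hv : G.Adj (p j) v) :
    ∀ i < j + 1,
      G.Adj (Function.update p (j + 1) v i) (Function.update p (j + 1) v (i + 1)) := by
  intro i hi
  rw [Function.update_of_ne (by omega : i ≠ j + 1)]
  by_cases hij : i = j
  · subst hij
    rwa [Function.update_self]
  · rw [Function.update_of_ne (by omega)]
    exact hp i (by omega)

theorem IsIncPath.extend {V : Type*} {G : SimpleGraph V} {r : Sym2 V → ℤ} {j : ℕ} {p : ℕ → V}
    (hp : IsIncPath G r (j + 1) p) {v : V} (hadj : G.Adj (p (j + 1)) v)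
    (hv : ∀ i ≤ j + 1, p i ≠ v) (hlt : r s(p j, p (j + 1)) < r s(p (j + 1), v)) :
    IsIncPath G r (j + 2) (Function.update p (j + 2) v) := by
  refine ⟨injOn_update hp.1 hv, adj_update hp.2.1 hadj, fun i hi => ?_⟩
  rw [Function.update_of_ne (by omega : i ≠ j + 2),
    Function.update_of_ne (by omega : i + 1 ≠ j + 2)]
  by_cases hij : i = j
  · subst hij
    rwa [Function.update_self]
  · rw [Function.update_of_ne (by omega)]
    exact hp.2.2 i (by omega)

/-- At every vertex `u` that ends an increasing path with `j + 1` edges, one may fix such a path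
`p u` whose last edge is smallest. -/
theorem exists_smallest_lastDart {V : Type*} [Finite V] (G : SimpleGraph V) (r : Sym2 V → ℤ)
    (j : ℕ) : ∃ p : V → ℕ → V, ∀ u x, IsLastDart G r j x u →
      IsIncPath G r (j + 1) (p u) ∧ p u (j + 1) = u ∧ r s(p u j, u) ≤ r s(x, u) := by
  have h : ∀ u, ∃ p : ℕ → V, ∀ x, IsLastDart G r j x u →
      IsIncPath G r (j + 1) p ∧ p (j + 1) = u ∧ r s(p j, u) ≤ r s(x, u) := by
    intro u
    by_cases hu : ∃ x, IsLastDart G r j x u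
    · obtain ⟨y, ⟨p, hp, hpy, hpu⟩, hmin⟩ := Set.exists_min_image {x | IsLastDart G r j x u}
        (fun x => r s(x, u)) (Set.toFinite _) hu
      exact ⟨p, fun x hx => ⟨hp, hpu, hpy ▸ hmin x hx⟩⟩
    · exact ⟨fun _ => u, fun x hx => absurd ⟨x, hx⟩ hu⟩
  choose p hp using h
  exact ⟨p, hp⟩

theorem card_image_prod_range_le {V : Type*} [Fintype V] [DecidableEq V] (p : V → ℕ → V) (c : ℕ) :
    (((Finset.univ : Finset V) ×ˢ Finset.range c).image fun a => (a.1, p a.1 a.2)).card ≤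
      c * Fintype.card V := by
  refine Finset.card_image_le.trans ?_
  rw [Finset.card_product, Finset.card_range, Finset.card_univ, mul_comm]

open Classical in
/-- All but linearly many darts end an increasing path with `j + 1` edges: a dart `u v` can only
fail if `v u` does not end a path with one edge less, or if `v` lies on the path fixed at `u`. -/
theorem card_not_isLastDart_le {V : Type*} [Fintype V] (G : SimpleGraph V) {r : Sym2 V → ℤ}
    (hr : Set.InjOn r G.edgeSet) (j : ℕ) :
    (Finset.univ.filter fun a : V × V => G.Adj a.1 a.2 ∧ ¬ IsLastDart G r j a.1 a.2).card ≤
      j ^ 2 * Fintype.card V := by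
  induction j with
  | zero =>
    rw [Nat.le_iff_lt_or_eq]
    right
    rw [zero_pow two_ne_zero, zero_mul, Finset.card_eq_zero, Finset.filter_eq_empty_iff]
    rintro ⟨u, v⟩ - ⟨huv, hnot⟩
    refine hnot ⟨fun i => if i = 0 then u else v, ⟨?_, ?_, by omega⟩, by simp, by simp⟩
    · intro a ha b hb hab
      simp only [Set.mem_Iic] at ha hb
      have := huv.ne
      dsimp only at hab this
      split_ifs at hab <;> first | omega | simp_all
    · intro i hi
      obtain rfl : i = 0 := by omega
      simpa using huv
  | succ j ih =>
    obtain ⟨p, hp⟩ := exists_smallest_lastDart G r j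
    have hsub : (Finset.univ.filter fun a : V × V =>
        G.Adj a.1 a.2 ∧ ¬ IsLastDart G r (j + 1) a.1 a.2) ⊆
        (Finset.univ.filter fun a : V × V =>
          G.Adj a.1 a.2 ∧ ¬ IsLastDart G r j a.1 a.2).image Prod.swap ∪
        ((Finset.univ : Finset V) ×ˢ Finset.range (j + 1)).image fun a => (a.1, p a.1 a.2) := by
      rintro ⟨u, v⟩ huv
      simp only [Finset.mem_filter, Finset.mem_univ, true_and] at huv
      obtain ⟨hadj, hnot⟩ := huv
      simp only [Finset.mem_union, Finset.mem_image, Finset.mem_filter, Finset.mem_univ, true_and,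
        Finset.mem_product, Finset.mem_range, Prod.exists, Prod.swap_prod_mk, Prod.mk.injEq]
      by_contra hcon
      push Not at hcon
      obtain ⟨h1, h2⟩ := hcon
      have hlast : IsLastDart G r j v u := by
        by_contra hl
        exact h1 v u ⟨hadj.symm, hl⟩ rfl rfl
      obtain ⟨hinc, hend, hle⟩ := hp u v hlast
      have hne : ∀ i ≤ j + 1, p u i ≠ v := by
        intro i hi hiv
        rcases Nat.lt_or_ge i (j + 1) with hi' | hi'
        · exact h2 u i hi' rfl hiv
        · obtain rfl : i = j + 1 := by omega
          exact hadj.ne (hend.symm.trans hiv)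
      refine hnot ⟨Function.update (p u) (j + 2) v, hinc.extend (by rwa [hend]) hne ?_, ?_, ?_⟩
      · rw [hend]
        refine lt_of_le_of_ne (hle.trans_eq (by rw [Sym2.eq_swap])) fun heq => ?_
        have := hr (by have := hinc.2.1 j (by omega); rwa [hend] at this) hadj heq
        rw [Sym2.eq_swap, Sym2.congr_right] at this
        exact hne j (by omega) this
      · rw [Function.update_of_ne (by omega), hend]
      · rw [Function.update_self]
    refine (Finset.card_le_card hsub).trans ((Finset.card_union_le _ _).trans ?_)
    have h1 := (Finset.card_image_le (f := Prod.swap)).trans ih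
    have h2 := card_image_prod_range_le p (j + 1)
    have h3 : j ^ 2 * Fintype.card V + (j + 1) * Fintype.card V ≤
        (j + 1) ^ 2 * Fintype.card V := by
      rw [← add_mul]
      exact Nat.mul_le_mul_right _ (by nlinarith)
    omega

open Classical in
theorem ncard_edgeSet_le_card_darts {V : Type*} [Fintype V] (G : SimpleGraph V) :
    G.edgeSet.ncard ≤ (Finset.univ.filter fun a : V × V => G.Adj a.1 a.2).card := by
  have hsub : G.edgeSet ⊆
      ((Finset.univ.filter fun a : V × V => G.Adj a.1 a.2).image fun a => s(a.1, a.2) :) := by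
    intro e
    induction e using Sym2.ind with
    | _ u v => exact fun h => Finset.mem_coe.2 (Finset.mem_image.2 ⟨(u, v), by simpa using h, rfl⟩)
  refine (Set.ncard_le_ncard hsub).trans ?_
  rw [Set.ncard_coe_finset]
  exact Finset.card_image_le

theorem exists_isIncPath {V : Type*} [Fintype V] (G : SimpleGraph V) {r : Sym2 V → ℤ}
    (hr : Set.InjOn r G.edgeSet) (j : ℕ) (hcard : j ^ 2 * Fintype.card V < G.edgeSet.ncard) :
    ∃ p, IsIncPath G r (j + 1) p := by
  classical
  have h := (card_not_isLastDart_le G hr j).trans_lt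
    (hcard.trans_le (ncard_edgeSet_le_card_darts G))
  obtain ⟨a, ha, hna⟩ := Finset.exists_mem_notMem_of_card_lt_card h
  simp only [Finset.mem_filter, Finset.mem_univ, true_and, not_and, not_not] at ha hna
  obtain ⟨p, hp, -⟩ := hna ha
  exact ⟨p, hp⟩

/-! ### Linear upper bounds: flipped paths -/

theorem card_filter_few_below_le {α : Type*} {S : Finset α} {f : α → ℤ}
    (hf : Set.InjOn f S) (c : ℕ) :
    (S.filter fun v => (S.filter fun w => f w < f v).card < c).card ≤ c := by
  rw [← Finset.card_range c]
  refine Finset.card_le_card_of_injOn (fun v => (S.filter fun w => f w < f v).card) ?_ ?_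
  · intro v hv
    simp only [Finset.coe_filter, Set.mem_ofPred_eq] at hv
    simpa using hv.2
  · have key : ∀ v ∈ S, ∀ w ∈ S, f v < f w →
        (S.filter fun a => f a < f v).card < (S.filter fun a => f a < f w).card := by
      intro v hv w _ hvw
      refine Finset.card_lt_card ⟨fun a ha => ?_, fun hsub => ?_⟩
      · simp only [Finset.mem_filter] at ha ⊢
        exact ⟨ha.1, ha.2.trans hvw⟩
      · simpa using hsub (Finset.mem_filter.2 ⟨hv, hvw⟩)
    intro v hv w hw hvw
    simp only [Finset.coe_filter, Set.mem_ofPred_eq] at hv hw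
    rcases lt_trichotomy (f v) (f w) with h | h | h
    · exact absurd hvw (key v hv.1 w hw.1 h).ne
    · exact hf hv.1 hw.1 h
    · exact absurd hvw (key w hw.1 v hv.1 h).ne'

open Classical in
/-- In a graph with sufficiently many edges, some edge `u v` lies, at both of its ends, far above
the smallest last edge of an increasing path with `j + 1` edges ending there. If the smallest last
edge at `u` is not above the one at `v`, then the path ending at `u` followed by `u v` can be
continued at `v` by an edge that is below `u v` but above all the others. -/
theorem exists_flipped_path {V : Type*} [Fintype V] (G : SimpleGraph V) {r : Sym2 V → ℤ}
    (hr : Set.InjOn r G.edgeSet) (j : ℕ)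
    (hcard : 2 * ((j ^ 2 + (j + 2) + (j + 3)) * Fintype.card V) < G.edgeSet.ncard) :
    ∃ p : ℕ → V, Set.InjOn p (Set.Iic (j + 3)) ∧ (∀ i < j + 3, G.Adj (p i) (p (i + 1))) ∧
      (∀ i, i + 1 < j + 1 → r s(p i, p (i + 1)) < r s(p (i + 1), p (i + 2))) ∧
      r s(p j, p (j + 1)) < r s(p (j + 2), p (j + 3)) ∧
      r s(p (j + 2), p (j + 3)) < r s(p (j + 1), p (j + 2)) := by
  obtain ⟨p, hp⟩ := exists_smallest_lastDart G r j
  -- the edges at `u` above the last edge of the path fixed at `u`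
  let S : V → Finset V := fun u => Finset.univ.filter fun w =>
    G.Adj u w ∧ r s(p u j, u) < r s(u, w)
  have hS : ∀ u, Set.InjOn (fun w => r s(u, w)) (S u) := by
    intro u v hv w hw hvw
    simp only [S, Finset.coe_filter, Finset.mem_univ, true_and, Set.mem_ofPred_eq] at hv hw
    exact Sym2.congr_right.1 (hr hv.1 hw.1 hvw)
  let few : V → V → Prop := fun u v => ((S u).filter fun w => r s(u, w) < r s(u, v)).card < j + 3
  let B : Finset (V × V) :=
    (Finset.univ.filter fun a : V × V =>
      G.Adj a.1 a.2 ∧ ¬ IsLastDart G r j a.1 a.2).image Prod.swap ∪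
    (((Finset.univ : Finset V) ×ˢ Finset.range (j + 2)).image fun a => (a.1, p a.1 a.2)) ∪
    (Finset.univ.sigma fun u => (S u).filter (few u)).image fun a => (a.1, a.2)
  have hB : B.card ≤ (j ^ 2 + (j + 2) + (j + 3)) * Fintype.card V := by
    refine (Finset.card_union_le _ _).trans ?_
    rw [add_mul, add_mul]
    refine add_le_add ((Finset.card_union_le _ _).trans (add_le_add
      (Finset.card_image_le.trans (card_not_isLastDart_le G hr j))
      (card_image_prod_range_le p _))) (Finset.card_image_le.trans ?_)
    rw [Finset.card_sigma]
    refine (Finset.sum_le_card_nsmul _ _ (j + 3) fun u _ =>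
      card_filter_few_below_le (hS u) (j + 3)).trans ?_
    rw [Finset.card_univ, smul_eq_mul, mul_comm]
  have hgood : ∀ u v, G.Adj u v → (u, v) ∉ B →
      IsIncPath G r (j + 1) (p u) ∧ p u (j + 1) = u ∧ (∀ i ≤ j + 1, p u i ≠ v) ∧ ¬ few u v := by
    intro u v hadj hnot
    simp only [B, Finset.mem_union, Finset.mem_image, Finset.mem_filter, Finset.mem_univ, true_and,
        Finset.mem_product, Finset.mem_range, Prod.exists, Prod.swap_prod_mk, Prod.mk.injEq,
        Finset.mem_sigma, Sigma.exists] at hnot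
    push Not at hnot
    obtain ⟨⟨h1, h2⟩, h3⟩ := hnot
    have hlast : IsLastDart G r j v u := by
      by_contra hl
      exact h1 v u ⟨hadj.symm, hl⟩ rfl rfl
    obtain ⟨hinc, hend, hle⟩ := hp u v hlast
    have hne : ∀ i ≤ j + 1, p u i ≠ v := fun i hi hiv => h2 u i (by omega) rfl hiv
    refine ⟨hinc, hend, hne, fun hfew => h3 u v ⟨?_, hfew⟩ rfl rfl⟩
    simp only [S, Finset.mem_filter, Finset.mem_univ, true_and]
    refine ⟨hadj, lt_of_le_of_ne (hle.trans_eq (by rw [Sym2.eq_swap])) fun heq => ?_⟩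
    have := hr (by have := hinc.2.1 j (by omega); rwa [hend] at this) hadj heq
    rw [Sym2.eq_swap, Sym2.congr_right] at this
    exact hne j (by omega) this
  have hex : ∃ a : V × V, G.Adj a.1 a.2 ∧ a ∉ B ∧ a.swap ∉ B := by
    have h : (B ∪ B.image Prod.swap).card <
        (Finset.univ.filter fun a : V × V => G.Adj a.1 a.2).card := by
      have h1 := ncard_edgeSet_le_card_darts G
      have h2 := Finset.card_union_le B (B.image Prod.swap)
      have h3 := Finset.card_image_le (s := B) (f := Prod.swap)
      omega
    obtain ⟨a, ha, hna⟩ := Finset.exists_mem_notMem_of_card_lt_card h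
    rw [Finset.mem_union, not_or] at hna
    exact ⟨a, by simpa using ha, hna.1, fun hs =>
      hna.2 (Finset.mem_image.2 ⟨a.swap, hs, Prod.swap_swap a⟩)⟩
  -- by symmetry the smallest last edge at `u` may be assumed not to be above the one at `v`
  obtain ⟨u, v, hadj, hu, hv, huv⟩ : ∃ u v, G.Adj u v ∧ (u, v) ∉ B ∧ (v, u) ∉ B ∧
      r s(p u j, u) ≤ r s(p v j, v) := by
    obtain ⟨⟨u, v⟩, hadj, hu, hv⟩ := hex
    rcases le_total (r s(p u j, u)) (r s(p v j, v)) with h | h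
    · exact ⟨u, v, hadj, hu, hv, h⟩
    · exact ⟨v, u, hadj.symm, hv, hu, h⟩
  obtain ⟨hinc, hend, hne, -⟩ := hgood u v hadj hu
  obtain ⟨-, -, -, hmany⟩ := hgood v u hadj.symm hv
  have hcardw : ((Finset.range (j + 2)).image (p u)).card <
      ((S v).filter fun w => r s(v, w) < r s(v, u)).card := by
    have h1 := Finset.card_image_le (s := Finset.range (j + 2)) (f := p u)
    rw [Finset.card_range] at h1
    have h2 := not_lt.1 hmany
    omega
  obtain ⟨w, hw, hwp⟩ := Finset.exists_mem_notMem_of_card_lt_card hcardw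
  simp only [S, Finset.mem_filter, Finset.mem_univ, true_and, Finset.mem_image, Finset.mem_range,
    not_exists, not_and] at hw hwp
  obtain ⟨⟨hvw, hlow⟩, hup⟩ := hw
  have hadj' : ∀ i < j + 2, G.Adj (Function.update (p u) (j + 2) v i)
      (Function.update (p u) (j + 2) v (i + 1)) := adj_update hinc.2.1 (by rwa [hend])
  have hval : ∀ i ≤ j + 1,
      Function.update (Function.update (p u) (j + 2) v) (j + 3) w i = p u i := by
    intro i hi
    rw [Function.update_of_ne (by omega), Function.update_of_ne (by omega)]
  have hval2 : Function.update (Function.update (p u) (j + 2) v) (j + 3) w (j + 2) = v := by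
    rw [Function.update_of_ne (by omega), Function.update_self]
  refine ⟨Function.update (Function.update (p u) (j + 2) v) (j + 3) w,
    injOn_update (injOn_update hinc.1 hne) fun i hi => ?_,
    adj_update hadj' (by rwa [Function.update_self]), fun i hi => ?_, ?_, ?_⟩
  · rcases Nat.lt_or_ge i (j + 2) with hi' | hi'
    · rw [Function.update_of_ne (by omega)]
      exact hwp i hi'
    · obtain rfl : i = j + 2 := by omega
      rw [Function.update_self]
      exact hvw.ne
  · rw [hval i (by omega), hval (i + 1) (by omega), hval (i + 2) (by omega)]
    exact hinc.2.2 i hi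
  · rw [hval j (by omega), hval (j + 1) le_rfl, hval2, Function.update_self, hend]
    exact huv.trans_lt hlow
  · rw [hval (j + 1) le_rfl, hval2, Function.update_self, hend]
    exact hup.trans_eq (by rw [Sym2.eq_swap])

/-- The edges of the path provided by `exists_flipped_path`, reordered by switching the last two,
form an increasing sequence. -/
theorem exists_flippedTop_path {V : Type*} [Fintype V] (G : SimpleGraph V) {r : Sym2 V → ℤ}
    (hr : Set.InjOn r G.edgeSet) (j : ℕ)
    (hcard : 2 * ((j ^ 2 + (j + 2) + (j + 3)) * Fintype.card V) < G.edgeSet.ncard) :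
    ∃ p : ℕ → V, Set.InjOn p (Set.Iic (j + 3)) ∧ (∀ i < j + 3, G.Adj (p i) (p (i + 1))) ∧
      ∀ a < j + 3, ∀ b < j + 3, r s(p a, p (a + 1)) < r s(p b, p (b + 1)) ↔
        Equiv.swap (j + 1) (j + 2) a < Equiv.swap (j + 1) (j + 2) b := by
  obtain ⟨p, hinj, hadj, hmono, h1, h2⟩ := exists_flipped_path G hr j hcard
  refine ⟨p, hinj, hadj, ?_⟩
  have hy : StrictMonoOn (fun m => r s(p (Equiv.swap (j + 1) (j + 2) m),
      p (Equiv.swap (j + 1) (j + 2) m + 1))) (Set.Iio (j + 3)) := by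
    apply strictMonoOn_Iio_of_lt_succ
    intro i hi
    rcases lt_trichotomy i j with h | rfl | h
    · rw [Equiv.swap_apply_of_ne_of_ne (by omega) (by omega),
        Equiv.swap_apply_of_ne_of_ne (by omega) (by omega)]
      exact hmono i (by omega)
    · rw [Equiv.swap_apply_of_ne_of_ne (by omega) (by omega), Equiv.swap_apply_left]
      exact h1
    · obtain rfl : i = j + 1 := by omega
      rw [Equiv.swap_apply_left, Equiv.swap_apply_right]
      exact h2
  have hlt : ∀ a < j + 3, Equiv.swap (j + 1) (j + 2) a < j + 3 := by
    intro a ha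
    rw [Equiv.swap_apply_def]
    split_ifs <;> omega
  intro a ha b hb
  have := hy.lt_iff_lt (Set.mem_Iio.2 (hlt a ha)) (Set.mem_Iio.2 (hlt b hb))
  simpa only [Equiv.swap_apply_self] using this

/-- Reversing both the edge-order and the path turns the flip of the two largest labels into the
flip of the two smallest ones. -/
theorem exists_flippedBottom_path {V : Type*} [Fintype V] (G : SimpleGraph V) {r : Sym2 V → ℤ}
    (hr : Set.InjOn r G.edgeSet) (j : ℕ)
    (hcard : 2 * ((j ^ 2 + (j + 2) + (j + 3)) * Fintype.card V) < G.edgeSet.ncard) :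
    ∃ p : ℕ → V, Set.InjOn p (Set.Iic (j + 3)) ∧ (∀ i < j + 3, G.Adj (p i) (p (i + 1))) ∧
      ∀ a < j + 3, ∀ b < j + 3, r s(p a, p (a + 1)) < r s(p b, p (b + 1)) ↔
        Equiv.swap 0 1 a < Equiv.swap 0 1 b := by
  obtain ⟨p, hinj, hadj, hlt⟩ := exists_flippedTop_path G (r := fun e => -r e)
    (fun e he f hf h => hr he hf (neg_injective h)) j hcard
  refine ⟨fun i => p (j + 3 - i), fun a ha b hb hab => ?_, fun i hi => ?_, fun a ha b hb => ?_⟩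
  · have := hinj (Set.mem_Iic.2 (by omega)) (Set.mem_Iic.2 (by omega)) hab
    simp only [Set.mem_Iic] at ha hb
    omega
  · have := (hadj (j + 3 - (i + 1)) (by omega)).symm
    rwa [show j + 3 - (i + 1) + 1 = j + 3 - i by omega] at this
  · have := hlt (j + 3 - (b + 1)) (by omega) (j + 3 - (a + 1)) (by omega)
    rw [show j + 3 - (a + 1) + 1 = j + 3 - a by omega,
      show j + 3 - (b + 1) + 1 = j + 3 - b by omega, neg_lt_neg_iff] at this
    rw [Sym2.eq_swap (a := p (j + 3 - a)), Sym2.eq_swap (a := p (j + 3 - b)), this]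
    simp only [Equiv.swap_apply_def]
    split_ifs <;> omega

/-- Up to the direction of traversal, a monotone or flipped path is labeled increasingly or by one
of the two switches of an increasing labeling. -/
theorem isPathLabeled_of_monotone_or_flipped {V : Type*} {P : EdgeOrderedGraph V} {k : ℕ}
    (h : P.IsMonotonePath k ∨ P.IsFlippedPath k) :
    P.IsPathLabeled (1 : Equiv.Perm (Fin k)) ∨
      ∃ _ : 3 ≤ k, P.IsPathLabeled (Equiv.swap (⟨0, by omega⟩ : Fin k) ⟨1, by omega⟩) ∨
        P.IsPathLabeled (Equiv.swap (⟨k - 2, by omega⟩ : Fin k) ⟨k - 1, by omega⟩) := by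
  rcases h with ⟨σ, hσ, hP⟩ | ⟨hk, σ, hσ, hP | hP⟩
  · exact Or.inl (isPathLabeled_of_mul_monotone hσ (by rwa [one_mul]))
  · exact Or.inr ⟨hk, Or.inl (isPathLabeled_of_mul_monotone hσ hP)⟩
  · exact Or.inr ⟨hk, Or.inr (isPathLabeled_of_mul_monotone hσ hP)⟩

theorem val_swap {k a b : ℕ} (ha : a < k) (hb : b < k) (i : Fin k) :
    (Equiv.swap (⟨a, ha⟩ : Fin k) ⟨b, hb⟩ i : ℕ) = Equiv.swap a b (i : ℕ) := by
  simp only [Equiv.swap_apply_def, Fin.ext_iff]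
  split_ifs <;> rfl

theorem extremalFunction_le {V : Type*} {P : EdgeOrderedGraph V} {k : ℕ} (hk : 2 ≤ k)
    (hne : P.graph.edgeSet.Nonempty) (h : P.IsMonotonePath k ∨ P.IsFlippedPath k) :
    ∃ C : ℕ, ∀ n, P.extremalFunction n ≤ C * n := by
  obtain ⟨C, hC⟩ : ∃ C : ℕ, ∀ n, ∀ G : EdgeOrderedGraph (Fin n),
      C * n < G.graph.edgeSet.ncard → G.Contains P := by
    rcases isPathLabeled_of_monotone_or_flipped h with ⟨φ, hφ⟩ | ⟨hk3, ⟨φ, hφ⟩ | ⟨φ, hφ⟩⟩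
    · obtain ⟨j, rfl⟩ : ∃ j, k = j + 1 := ⟨k - 1, by omega⟩
      refine ⟨j ^ 2, fun n G hG => ?_⟩
      obtain ⟨r, hr⟩ := G.exists_isKey
      obtain ⟨p, hinj, hadj, hmono⟩ :=
        exists_isIncPath G.graph hr.injOn j (by rwa [Fintype.card_fin])
      exact contains_of_path φ (x := fun i => i) hφ hr hinj hadj fun a ha b hb =>
        (strictMonoOn_Iio_of_lt_succ (f := fun i => r s(p i, p (i + 1))) hmono).lt_iff_lt ha hb
    · obtain ⟨j, rfl⟩ : ∃ j, k = j + 3 := ⟨k - 3, by omega⟩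
      refine ⟨2 * (j ^ 2 + (j + 2) + (j + 3)), fun n G hG => ?_⟩
      obtain ⟨r, hr⟩ := G.exists_isKey
      obtain ⟨p, hinj, hadj, hlt⟩ := exists_flippedBottom_path G.graph hr.injOn j
        (by rwa [Fintype.card_fin, ← mul_assoc])
      refine contains_of_path φ (x := fun i => Equiv.swap 0 1 i) (fun a b => ?_) hr hinj hadj hlt
      rw [hφ, Fin.lt_def, val_swap, val_swap]
    · obtain ⟨j, rfl⟩ : ∃ j, k = j + 3 := ⟨k - 3, by omega⟩
      refine ⟨2 * (j ^ 2 + (j + 2) + (j + 3)), fun n G hG => ?_⟩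
      obtain ⟨r, hr⟩ := G.exists_isKey
      obtain ⟨p, hinj, hadj, hlt⟩ := exists_flippedTop_path G.graph hr.injOn j
        (by rwa [Fintype.card_fin, ← mul_assoc])
      refine contains_of_path φ (x := fun i => Equiv.swap (j + 1) (j + 2) i) (fun a b => ?_)
        hr hinj hadj hlt
      rw [hφ, Fin.lt_def, val_swap, val_swap]
      rfl
  refine ⟨C, fun n => ?_⟩
  obtain ⟨G, hG, hGm⟩ := (P.isGreatest_extremalFunction hne n).1
  rw [← hGm]
  exact not_lt.1 fun hlt => hG (hC n G hlt)

/-! ### The linear lower bound -/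

/-- The matching on `Fin n` formed by the edges `{2 i, 2 i + 1}`. -/
def matchingGraph (n : ℕ) : SimpleGraph (Fin n) where
  Adj u v := u ≠ v ∧ (u : ℕ) / 2 = (v : ℕ) / 2
  symm := ⟨fun _ _ h => ⟨h.1.symm, h.2.symm⟩⟩
  loopless := ⟨fun _ h => h.1 rfl⟩

theorem le_ncard_edgeSet_matchingGraph (n : ℕ) : n / 2 ≤ (matchingGraph n).edgeSet.ncard := by
  let f : Fin (n / 2) → Sym2 (Fin n) := fun i => s(⟨2 * i, by omega⟩, ⟨2 * i + 1, by omega⟩)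
  have hf : Function.Injective f := by
    intro i j hij
    simp only [f, Sym2.eq_iff, Fin.mk.injEq] at hij
    omega
  have hsub : Set.range f ⊆ (matchingGraph n).edgeSet := by
    rintro _ ⟨i, rfl⟩
    refine ⟨fun h => ?_, ?_⟩
    · have := congrArg Fin.val h
      simp only at this
      omega
    · change 2 * (i : ℕ) / 2 = (2 * (i : ℕ) + 1) / 2
      omega
  have := Set.ncard_le_ncard hsub
  rwa [Set.ncard_range_of_injective hf, Nat.card_eq_fintype_card, Fintype.card_fin] at this

theorem div_two_le_extremalFunction {V : Type*} {P : EdgeOrderedGraph V} {k : ℕ} (hk : 2 ≤ k)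
    (hP : P.IsPath k) (hne : P.graph.edgeSet.Nonempty) (n : ℕ) :
    n / 2 ≤ P.extremalFunction n := by
  obtain ⟨φ⟩ := hP
  obtain ⟨r⟩ : Nonempty (LinearOrder (matchingGraph n).edgeSet) :=
    ⟨LinearOrder.lift' _ (Finite.equivFin _).injective⟩
  refine (le_ncard_edgeSet_matchingGraph n).trans
    (ncard_edgeSet_le_extremalFunction hne (G := ⟨matchingGraph n, r⟩) ?_)
  rintro ⟨f, -⟩
  have hadj : ∀ i (hi : i < k),
      (matchingGraph n).Adj (f (φ ⟨i, by omega⟩)) (f (φ ⟨i + 1, by omega⟩)) := fun i hi =>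
    f.toHom.map_adj (φ.map_adj_iff.2 (SimpleGraph.pathGraph_adj.2 (Or.inl rfl)))
  have h0 := hadj 0 (by omega)
  have h1 := hadj 1 (by omega)
  have h2 : f (φ ⟨0, by omega⟩) ≠ f (φ ⟨2, by omega⟩) := fun h => by
    simpa using φ.injective (f.injective h)
  have h3 := h0.1
  have h4 := h1.1
  have h5 := h0.2
  have h6 := h1.2
  simp only [Fin.ext_iff, ne_eq, zero_add, Nat.reduceAdd] at h2 h3 h4 h5 h6
  omega

/-! ### Graphs with many edges whose lengths are powers of two -/

/-- The pair `(a, b)` with `a < N` and `b - a = N + 2 ^ e` for some `e`. The summand `N` makes the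
graph formed by these pairs bipartite: the lower end of an edge is below `N`, the upper one is
not. -/
def PowStep (N a b : ℕ) : Prop := a < N ∧ ∃ e, b = a + N + 2 ^ e

theorem PowStep.lt {N a b : ℕ} (h : PowStep N a b) : a < N ∧ a + N < b := by
  obtain ⟨h, e, rfl⟩ := h
  have := Nat.one_le_two_pow (n := e)
  omega

theorem PowStep.not_lt {N a b : ℕ} (h : PowStep N a b) : ¬ b < N := by
  have := h.lt
  omega

/-- Of two different powers of two, the larger one is at least twice the smaller one. -/
theorem PowStep.two_mul_le {N a b a' b' : ℕ} (h : PowStep N a b) (h' : PowStep N a' b')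
    (hlt : b + a' < b' + a) : 2 * b + a' ≤ b' + 2 * a + N := by
  obtain ⟨-, e, rfl⟩ := h
  obtain ⟨-, e', rfl⟩ := h'
  have hee : 2 ^ e < 2 ^ e' := by omega
  have h1 := Nat.pow_le_pow_right (n := 2) (by omega)
    (Nat.succ_le_of_lt ((Nat.pow_lt_pow_iff_right (by omega)).1 hee))
  rw [Nat.succ_eq_add_one, pow_succ] at h1
  omega

/-- The graph on `Fin n` whose edges are the pairs in `PowStep (n / 4)`. -/
def powGraph (n : ℕ) : SimpleGraph (Fin n) where
  Adj u v := PowStep (n / 4) u v ∨ PowStep (n / 4) v u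
  symm := ⟨fun _ _ h => h.symm⟩
  loopless := ⟨fun _ h => by rcases h with h | h <;> exact absurd h.lt (by omega)⟩

theorem le_ncard_edgeSet_powGraph (n : ℕ) :
    n / 4 * Nat.log 2 n ≤ (powGraph n).edgeSet.ncard := by
  have hlt : ∀ a : Fin (n / 4) × Fin (Nat.log 2 n), a.1 + n / 4 + 2 ^ (a.2 : ℕ) < n := by
    rintro ⟨⟨u, hu⟩, ⟨e, he⟩⟩
    have h1 : 2 ^ (e + 1) ≤ n := (Nat.pow_le_pow_right (by omega) he).trans
      (Nat.pow_log_le_self 2 (by omega))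
    rw [pow_succ] at h1
    simp only
    omega
  let f : Fin (n / 4) × Fin (Nat.log 2 n) → Sym2 (Fin n) := fun a =>
    s(⟨a.1, by have := hlt a; omega⟩, ⟨a.1 + n / 4 + 2 ^ (a.2 : ℕ), hlt a⟩)
  have hf : Function.Injective f := by
    rintro ⟨⟨u, hu⟩, ⟨e, he⟩⟩ ⟨⟨u', hu'⟩, ⟨e', he'⟩⟩ h
    have h1 := Nat.one_le_two_pow (n := e)
    have h2 := Nat.one_le_two_pow (n := e')
    simp only [f, Sym2.eq_iff, Fin.mk.injEq] at h
    obtain ⟨rfl, h3⟩ : u = u' ∧ 2 ^ e = 2 ^ e' := by omega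
    obtain rfl := Nat.pow_right_injective le_rfl h3
    rfl
  have hsub : Set.range f ⊆ (powGraph n).edgeSet := by
    rintro _ ⟨a, rfl⟩
    exact Or.inl ⟨a.1.2, a.2, rfl⟩
  have := Set.ncard_le_ncard hsub
  rwa [Set.ncard_range_of_injective hf, Nat.card_eq_fintype_card, Fintype.card_prod,
    Fintype.card_fin, Fintype.card_fin] at this

/-- The value of the pair `{a, b}`, `a ≤ b`, is `(α a + β b, γ a + δ b)`, and these values are
compared lexicographically. -/
def linKey {n : ℕ} (α β γ δ : ℤ) (e : Sym2 (Fin n)) : ℤ ×ₗ ℤ :=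
  toLex (α * (e.inf : ℕ) + β * (e.sup : ℕ), γ * (e.inf : ℕ) + δ * (e.sup : ℕ))

theorem linKey_injective {n : ℕ} {α β γ δ : ℤ} (h : α * δ - β * γ ≠ 0) :
    Function.Injective (linKey (n := n) α β γ δ) := by
  intro e f hef
  simp only [linKey, EmbeddingLike.apply_eq_iff_eq, Prod.mk.injEq] at hef
  obtain ⟨h1, h2⟩ := hef
  have h3 : (α * δ - β * γ) * (((e.inf : ℕ) : ℤ) - (f.inf : ℕ)) = 0 := by
    linear_combination δ * h1 - β * h2
  have h4 : (α * δ - β * γ) * (((e.sup : ℕ) : ℤ) - (f.sup : ℕ)) = 0 := by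
    linear_combination α * h2 - γ * h1
  have h5 := (mul_eq_zero.1 h3).resolve_left h
  have h6 := (mul_eq_zero.1 h4).resolve_left h
  exact Sym2.inf_eq_inf_and_sup_eq_sup.1 ⟨Fin.ext (by omega), Fin.ext (by omega)⟩

/-- The path `w 0, …, w k` in the graph of the pairs in `PowStep N`, with edges ordered by
`linKey α β γ δ`, is labeled by `x 0, …, x (k - 1)`. -/
structure IsPowPath (N : ℕ) (α β γ δ : ℤ) (k : ℕ) (w : ℕ → ℕ) (x : ℕ → ℤ) : Prop where
  injOn : Set.InjOn w (Set.Iic k)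
  step : ∀ i < k, PowStep N (w i) (w (i + 1)) ∨ PowStep N (w (i + 1)) (w i)
  lt_iff : ∀ i < k, ∀ j < k, ∀ a b a' b' : ℕ, s(w i, w (i + 1)) = s(a, b) → a ≤ b →
    s(w j, w (j + 1)) = s(a', b') → a' ≤ b' →
      (x i < x j ↔ α * a + β * b < α * a' + β * b' ∨
        α * a + β * b = α * a' + β * b' ∧ γ * a + δ * b < γ * a' + δ * b')

theorem exists_isPowPath {V : Type*} {P : EdgeOrderedGraph V} {k : ℕ}
    (φ : SimpleGraph.pathGraph (k + 1) ≃g P.graph) {x : ℕ → ℤ}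
    (hx : ∀ i j : Fin k, P.EdgeLT (pathEdge φ i) (pathEdge φ j) ↔ x i < x j) {n : ℕ}
    {α β γ δ : ℤ} (h : α * δ - β * γ ≠ 0)
    (hP : (ofKey (powGraph n) (linKey α β γ δ) (linKey_injective h).injOn).Contains P) :
    ∃ w, IsPowPath (n / 4) α β γ δ k w x := by
  obtain ⟨p, hinj, hadj, hlt⟩ := exists_path_of_contains φ hx (isKey_ofKey _ _ _) hP
  refine ⟨fun i => p i, fun a ha b hb hab => hinj ha hb (Fin.ext hab), hadj, ?_⟩
  have hval : ∀ i, ∀ a b : ℕ, s((p i : ℕ), (p (i + 1) : ℕ)) = s(a, b) → a ≤ b →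
      linKey α β γ δ s(p i, p (i + 1)) = toLex (α * a + β * b, γ * a + δ * b) := by
    intro i a b hab hle
    have h1 : ((s(p i, p (i + 1)).inf : Fin n) : ℕ) = a := by
      rw [Sym2.inf_mk, Fin.coe_min]
      rw [Sym2.eq_iff] at hab
      omega
    have h2 : ((s(p i, p (i + 1)).sup : Fin n) : ℕ) = b := by
      rw [Sym2.sup_mk, Fin.coe_max]
      rw [Sym2.eq_iff] at hab
      omega
    rw [linKey, h1, h2]
  intro i hi j hj a b a' b' hab hle hab' hle'
  rw [← hlt i hi j hj, hval i a b hab hle, hval j a' b' hab' hle', Prod.Lex.toLex_lt_toLex]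

/-- Along a path the vertices below and above `N` alternate. -/
theorem IsPowPath.lt_iff_even {N k : ℕ} {α β γ δ : ℤ} {w : ℕ → ℕ} {x : ℕ → ℤ}
    (h : IsPowPath N α β γ δ k w x) : ∀ i ≤ k, (w i < N ↔ (w 0 < N ↔ Even i)) := by
  intro i
  induction i with
  | zero => simp
  | succ i ih =>
    intro hi
    have h1 := ih (by omega)
    have h2 : w (i + 1) < N ↔ ¬ w i < N := by
      rcases h.step i (by omega) with h | h <;> have := h.lt <;> omega
    rw [h2, h1, Nat.even_add_one]
    tauto

theorem IsPowPath.step_up {N k : ℕ} {α β γ δ : ℤ} {w : ℕ → ℕ} {x : ℕ → ℤ}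
    (h : IsPowPath N α β γ δ k w x) {i : ℕ} (hi : i < k) (hw : w i < N) :
    PowStep N (w i) (w (i + 1)) :=
  (h.step i hi).resolve_right fun h' => by have := h'.lt; omega

theorem IsPowPath.step_down {N k : ℕ} {α β γ δ : ℤ} {w : ℕ → ℕ} {x : ℕ → ℤ}
    (h : IsPowPath N α β γ δ k w x) {i : ℕ} (hi : i < k) (hw : ¬ w i < N) :
    PowStep N (w (i + 1)) (w i) :=
  (h.step i hi).resolve_left fun h' => hw h'.lt.1

/-! ### Four consecutive edges of a path -/

/-- The labels `y₀, y₁` are both below or both above the labels `y₂, y₃`. -/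
def Separated (y₀ y₁ y₂ y₃ : ℤ) : Prop :=
  (y₀ < y₂ ∧ y₀ < y₃ ∧ y₁ < y₂ ∧ y₁ < y₃) ∨ (y₂ < y₀ ∧ y₃ < y₀ ∧ y₂ < y₁ ∧ y₃ < y₁)

/-- In the order by lower ends, two consecutive edges that share their lower end are consecutive
in the order. So either four edges are separated, or it is the two middle ones that share their
lower end `a₁`. -/
theorem IsPowPath.separated_or {N k : ℕ} {ε δ : ℤ} {w : ℕ → ℕ} {x : ℕ → ℤ}
    (h : IsPowPath N ε 0 0 δ k w x) (hε : ε = 1 ∨ ε = -1) {i : ℕ} (hi : i + 3 < k) :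
    Separated (x i) (x (i + 1)) (x (i + 2)) (x (i + 3)) ∨
    ∃ a₀ b₀ a₁ b₁ a₂ : ℕ, PowStep N a₀ b₀ ∧ PowStep N a₁ b₀ ∧ PowStep N a₁ b₁ ∧ PowStep N a₂ b₁ ∧
      a₀ ≠ a₁ ∧ a₁ ≠ a₂ ∧ a₀ ≠ a₂ ∧ b₀ ≠ b₁ ∧
      (x i < x (i + 1) ↔ ε * a₀ < ε * a₁) ∧ (x i < x (i + 2) ↔ ε * a₀ < ε * a₁) ∧
      (x (i + 3) < x (i + 1) ↔ ε * a₂ < ε * a₁) ∧ (x (i + 3) < x (i + 2) ↔ ε * a₂ < ε * a₁) ∧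
      (x i < x (i + 3) ↔ ε * a₀ < ε * a₂) ∧ (x (i + 1) < x (i + 2) ↔ δ * b₀ < δ * b₁) := by
  have hne : ∀ s t, s ≤ k → t ≤ k → s ≠ t → w s ≠ w t := fun s t hs ht hst he =>
    hst (h.injOn (Set.mem_Iic.2 hs) (Set.mem_Iic.2 ht) he)
  have hmul : ∀ a a' : ℕ, a ≠ a' → ε * a ≠ ε * a' := by
    intro a a' haa
    rcases hε with rfl | rfl <;> omega
  by_cases hw : w i < N
  swap
  · have h0 := h.step_down (by omega) hw
    have h1 := h.step_up (i := i + 1) (by omega) h0.lt.1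
    have h2 := h.step_down (i := i + 2) (by omega) h1.not_lt
    have h3 := h.step_up (i := i + 3) (by omega) h2.lt.1
    left
    have hlt : ∀ s t, s < k → t < k → ∀ b b', s(w s, w (s + 1)) = s(w (i + 1), b) →
        w (i + 1) ≤ b → s(w t, w (t + 1)) = s(w (i + 3), b') → w (i + 3) ≤ b' →
        (ε * w (i + 1) < ε * w (i + 3) → x s < x t) ∧
        (ε * w (i + 3) < ε * w (i + 1) → x t < x s) := by
      intro s t hs ht b b' hb hle hb' hle'
      rw [h.lt_iff s hs t ht _ _ _ _ hb hle hb' hle', h.lt_iff t ht s hs _ _ _ _ hb' hle' hb hle]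
      constructor <;> intro hh <;> left <;> linarith
    have l0 := h0.lt
    have l1 := h1.lt
    have l2 := h2.lt
    have l3 := h3.lt
    have e02 := hlt i (i + 2) (by omega) (by omega) _ _ Sym2.eq_swap (by omega) Sym2.eq_swap
      (by omega)
    have e03 := hlt i (i + 3) (by omega) (by omega) _ _ Sym2.eq_swap (by omega) rfl (by omega)
    have e12 := hlt (i + 1) (i + 2) (by omega) (by omega) _ _ rfl (by omega) Sym2.eq_swap
      (by omega)
    have e13 := hlt (i + 1) (i + 3) (by omega) (by omega) _ _ rfl (by omega) rfl (by omega)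
    rcases lt_or_gt_of_ne (hmul _ _ (hne (i + 1) (i + 3) (by omega) (by omega) (by omega)))
      with hh | hh
    · exact Or.inl ⟨e02.1 hh, e03.1 hh, e12.1 hh, e13.1 hh⟩
    · exact Or.inr ⟨e02.2 hh, e03.2 hh, e12.2 hh, e13.2 hh⟩
  · have h0 := h.step_up (by omega) hw
    have h1 := h.step_down (i := i + 1) (by omega) h0.not_lt
    have h2 := h.step_up (i := i + 2) (by omega) h1.lt.1
    have h3 := h.step_down (i := i + 3) (by omega) h2.not_lt
    right
    have l0 := h0.lt
    have l1 := h1.lt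
    have l2 := h2.lt
    have l3 := h3.lt
    have n02 := hne i (i + 2) (by omega) (by omega) (by omega)
    have n24 := hne (i + 2) (i + 4) (by omega) (by omega) (by omega)
    have n04 := hne i (i + 4) (by omega) (by omega) (by omega)
    have n13 := hne (i + 1) (i + 3) (by omega) (by omega) (by omega)
    have hlt : ∀ s t, s < k → t < k → ∀ a b a' b', s(w s, w (s + 1)) = s(a, b) →
        a ≤ b → s(w t, w (t + 1)) = s(a', b') → a' ≤ b' → a ≠ a' →
        (x s < x t ↔ ε * a < ε * a') := by
      intro s t hs ht a b a' b' hb hle hb' hle' haa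
      rw [h.lt_iff s hs t ht _ _ _ _ hb hle hb' hle']
      have := hmul a a' haa
      constructor
      · rintro (hh | ⟨hh, -⟩)
        · linarith
        · exact absurd (by linarith) this
      · intro hh
        left
        linarith
    refine ⟨_, _, _, _, _, h0, h1, h2, h3, n02, n24, n04, n13, ?_, ?_, ?_, ?_, ?_, ?_⟩
    · exact hlt i (i + 1) (by omega) (by omega) _ _ _ _ rfl (by omega) Sym2.eq_swap (by omega) n02
    · exact hlt i (i + 2) (by omega) (by omega) _ _ _ _ rfl (by omega) rfl (by omega) n02
    · exact hlt (i + 3) (i + 1) (by omega) (by omega) _ _ _ _ Sym2.eq_swap (by omega) Sym2.eq_swap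
        (by omega) n24.symm
    · exact hlt (i + 3) (i + 2) (by omega) (by omega) _ _ _ _ Sym2.eq_swap (by omega) rfl
        (by omega) n24.symm
    · exact hlt i (i + 3) (by omega) (by omega) _ _ _ _ rfl (by omega) Sym2.eq_swap (by omega) n04
    · rw [h.lt_iff (i + 1) (by omega) (i + 2) (by omega) _ _ _ _ Sym2.eq_swap (by omega) rfl
        (by omega)]
      simp

/-- An edge `a₁ b₀` with `b₁ < b₀` is at least twice as long as `a₁ b₁`, and at least twice as long
as `a₀ b₀` if `a₁ < a₀`. So `b₁ - N` and `a₀` lie in different halves of the interval from `a₁`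
to `b₀ - N`, and `a₂ < b₁ - N` cannot be above `a₀`. -/
theorem PowStep.not_lt_lt {N a₀ b₀ a₁ b₁ a₂ : ℕ} (s₀ : PowStep N a₀ b₀) (s₁ : PowStep N a₁ b₀)
    (s₂ : PowStep N a₁ b₁) (s₃ : PowStep N a₂ b₁) : ¬ (a₁ < a₀ ∧ a₀ < a₂ ∧ b₁ < b₀) := by
  rintro ⟨c1, c2, c3⟩
  have d1 := s₂.two_mul_le s₁ (by omega)
  have d2 := s₀.two_mul_le s₁ (by omega)
  have := s₃.lt
  omega

theorem PowStep.lt_iff_lt {N a₀ b₀ a₁ b₁ a₂ : ℕ} (s₀ : PowStep N a₀ b₀) (s₁ : PowStep N a₁ b₀)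
    (s₂ : PowStep N a₁ b₁) (s₃ : PowStep N a₂ b₁) (hb : b₀ ≠ b₁) (ha : a₀ ≠ a₂) (h₀ : a₁ < a₀)
    (h₂ : a₁ < a₂) : a₀ < a₂ ↔ b₀ < b₁ := by
  have h₁ := s₀.not_lt_lt s₁ s₂ s₃
  have h₂ := s₃.not_lt_lt s₂ s₁ s₀
  omega

/-- Consequences of the order by lower ends for four consecutive edges that are not separated: each
of the outer edges compares in the same way with both middle edges, and if the outer edges are
above the middle ones (below, in case `ε = -1`), then the order of the middle edges determines the
order of the outer ones, in a way that depends on `δ`. -/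
theorem IsPowPath.separated_or_iff {N k : ℕ} {ε δ : ℤ} {w : ℕ → ℕ} {x : ℕ → ℤ}
    (h : IsPowPath N ε 0 0 δ k w x) (hε : ε = 1 ∨ ε = -1) (hδ : δ = 1 ∨ δ = -1) {i : ℕ}
    (hi : i + 3 < k) :
    Separated (x i) (x (i + 1)) (x (i + 2)) (x (i + 3)) ∨
      ((x i < x (i + 1) ↔ x i < x (i + 2)) ∧ (x (i + 3) < x (i + 1) ↔ x (i + 3) < x (i + 2)) ∧
      (ε = 1 → x (i + 1) < x i → x (i + 1) < x (i + 3) →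
        (x i < x (i + 3) ↔ (x (i + 1) < x (i + 2) ↔ δ = 1))) ∧
      (ε = -1 → x i < x (i + 1) → x (i + 3) < x (i + 1) →
        (x i < x (i + 3) ↔ ¬ (x (i + 1) < x (i + 2) ↔ δ = 1)))) := by
  rcases h.separated_or hε hi with h | ⟨a₀, b₀, a₁, b₁, a₂, s₀, s₁, s₂, s₃, n₁, n₂, n₃, n₄, e₁, e₂,
    e₃, e₄, e₅, e₆⟩
  · exact Or.inl h
  refine Or.inr ⟨e₁.trans e₂.symm, e₃.trans e₄.symm, ?_, ?_⟩
  · rintro rfl c₀ c₃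
    have c₀' := fun hh => c₀.not_gt (e₁.2 hh)
    have c₃' := fun hh => c₃.not_gt (e₃.2 hh)
    have := s₀.lt_iff_lt s₁ s₂ s₃ n₄ n₃ (by omega) (by omega)
    rw [e₅, e₆]
    rcases hδ with rfl | rfl <;> omega
  · rintro rfl c₀ c₃
    have c₀' := e₁.1 c₀
    have c₃' := e₃.1 c₃
    have := s₀.lt_iff_lt s₁ s₂ s₃ n₄ n₃ (by omega) (by omega)
    rw [e₅, e₆]
    rcases hδ with rfl | rfl <;> omega

/-- The four orders by lower ends leave only the patterns `1324` and `4231` for four consecutive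
edges that are not separated. -/
theorem separated_or_crossed {N k : ℕ} {w₁ w₂ w₃ w₄ : ℕ → ℕ} {x : ℕ → ℤ}
    (h₁ : IsPowPath N 1 0 0 1 k w₁ x) (h₂ : IsPowPath N 1 0 0 (-1) k w₂ x)
    (h₃ : IsPowPath N (-1) 0 0 1 k w₃ x) (h₄ : IsPowPath N (-1) 0 0 (-1) k w₄ x)
    (hx : Set.InjOn x (Set.Iio k)) {i : ℕ} (hi : i + 3 < k) :
    Separated (x i) (x (i + 1)) (x (i + 2)) (x (i + 3)) ∨
      (x i < x (i + 2) ∧ x (i + 2) < x (i + 1) ∧ x (i + 1) < x (i + 3)) ∨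
      (x (i + 3) < x (i + 1) ∧ x (i + 1) < x (i + 2) ∧ x (i + 2) < x i) := by
  rcases h₁.separated_or_iff (Or.inl rfl) (Or.inl rfl) hi with h | ⟨g₁, g₂, e₁, -⟩
  · exact Or.inl h
  rcases h₂.separated_or_iff (Or.inl rfl) (Or.inr rfl) hi with h | ⟨-, -, e₂, -⟩
  · exact Or.inl h
  rcases h₃.separated_or_iff (Or.inr rfl) (Or.inl rfl) hi with h | ⟨-, -, -, e₃⟩
  · exact Or.inl h
  rcases h₄.separated_or_iff (Or.inr rfl) (Or.inr rfl) hi with h | ⟨-, -, -, e₄⟩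
  · exact Or.inl h
  have hne : ∀ s t, s < k → t < k → s ≠ t → x s ≠ x t := fun s t hs ht hst he =>
    hst (hx (Set.mem_Iio.2 hs) (Set.mem_Iio.2 ht) he)
  have n₁ := hne i (i + 1) (by omega) (by omega) (by omega)
  have n₂ := hne i (i + 2) (by omega) (by omega) (by omega)
  have n₃ := hne (i + 3) (i + 1) (by omega) (by omega) (by omega)
  have n₄ := hne (i + 3) (i + 2) (by omega) (by omega) (by omega)
  have n₅ := hne (i + 1) (i + 2) (by omega) (by omega) (by omega)
  have habove : ¬ (x (i + 1) < x i ∧ x (i + 1) < x (i + 3)) := by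
    rintro ⟨c₀, c₃⟩
    have f₁ := (e₁ rfl c₀ c₃).trans (iff_true_right rfl)
    have f₂ := (e₂ rfl c₀ c₃).trans (iff_false_right (by norm_num))
    exact iff_not_self (f₁.symm.trans f₂)
  have hbelow : ¬ (x i < x (i + 1) ∧ x (i + 3) < x (i + 1)) := by
    rintro ⟨c₀, c₃⟩
    have f₃ := (e₃ rfl c₀ c₃).trans (not_congr (iff_true_right rfl))
    have f₄ := (e₄ rfl c₀ c₃).trans (not_congr (iff_false_right (by norm_num)))
    exact iff_not_self (f₃.symm.trans f₄)
  clear e₁ e₂ e₃ e₄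
  simp only [Separated]
  omega

/-! ### The order by `a + b` -/

/-- If `b' < b`, then `a b` is at least twice as long as `a b'`, so the midpoint of `a b` is above
`b'`, and hence above the midpoint of `a' b'`, where lengths are counted without the summand `N`. -/
theorem PowStep.add_lt_add_of_upper_lt {N a b a' b' : ℕ} (s₁ : PowStep N a b)
    (s₂ : PowStep N a b') (s₃ : PowStep N a' b') (hb : b' < b) : a' + b' < a + b := by
  have d := s₂.two_mul_le s₁ (by omega)
  have := s₃.lt
  omega

theorem PowStep.add_lt_add_of_lower_lt {N a b a' b' : ℕ} (s₁ : PowStep N a b)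
    (s₂ : PowStep N a' b) (s₃ : PowStep N a' b') (ha : a < a') : a + b < a' + b' := by
  have d := s₂.two_mul_le s₁ (by omega)
  have := s₃.lt
  omega

/-- In the order by `a + b`, an edge followed at its lower end by a smaller edge is also above the
edge after that one. -/
theorem IsPowPath.lt_of_lower {N k : ℕ} {w : ℕ → ℕ} {x : ℕ → ℤ} (h : IsPowPath N 1 1 1 0 k w x)
    {i : ℕ} (hi : i + 2 < k) (hw : w (i + 1) < N) (hx : x (i + 1) < x i) : x (i + 2) < x i := by
  have s₀ := h.step_down (i := i) (by omega) fun hw0 => (h.step_up (by omega) hw0).not_lt hw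
  have s₁ : PowStep N (w (i + 1)) (w (i + 2)) := h.step_up (i := i + 1) (by omega) hw
  have s₂ : PowStep N (w (i + 3)) (w (i + 2)) := h.step_down (i := i + 2) (by omega) s₁.not_lt
  have l₀ := s₀.lt
  have l₁ := s₁.lt
  have l₂ := s₂.lt
  have e₁ := h.lt_iff (i + 1) (by omega) i (by omega) (w (i + 1)) (w (i + 2)) (w (i + 1)) (w i)
    rfl (by omega) Sym2.eq_swap (by omega)
  have e₂ := h.lt_iff (i + 2) hi i (by omega) (w (i + 3)) (w (i + 2)) (w (i + 1)) (w i)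
    Sym2.eq_swap (by omega) Sym2.eq_swap (by omega)
  rw [e₁] at hx
  rw [e₂]
  have := s₀.add_lt_add_of_upper_lt s₁ s₂ (by omega)
  omega

theorem IsPowPath.lt_of_upper {N k : ℕ} {w : ℕ → ℕ} {x : ℕ → ℤ} (h : IsPowPath N 1 1 1 0 k w x)
    {i : ℕ} (hi : i + 2 < k) (hw : ¬ w (i + 1) < N) (hx : x i < x (i + 1)) : x i < x (i + 2) := by
  have s₀ := h.step_up (i := i) (by omega) (by
    by_contra hw0
    exact hw (h.step_down (by omega) hw0).lt.1)
  have s₁ : PowStep N (w (i + 2)) (w (i + 1)) := h.step_down (i := i + 1) (by omega) hw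
  have s₂ : PowStep N (w (i + 2)) (w (i + 3)) := h.step_up (i := i + 2) (by omega) s₁.lt.1
  have l₀ := s₀.lt
  have l₁ := s₁.lt
  have l₂ := s₂.lt
  have e₁ := h.lt_iff i (by omega) (i + 1) (by omega) (w i) (w (i + 1)) (w (i + 2)) (w (i + 1))
    rfl (by omega) Sym2.eq_swap (by omega)
  have e₂ := h.lt_iff i (by omega) (i + 2) hi (w i) (w (i + 1)) (w (i + 2)) (w (i + 3))
    rfl (by omega) rfl (by omega)
  rw [e₁] at hx
  rw [e₂]
  have := s₀.add_lt_add_of_lower_lt s₁ s₂ (by omega)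
  omega

/-- The path traversed from its other end. -/
theorem IsPowPath.reverse {N k : ℕ} {α β γ δ : ℤ} {w : ℕ → ℕ} {x : ℕ → ℤ}
    (h : IsPowPath N α β γ δ k w x) :
    IsPowPath N α β γ δ k (fun i => w (k - i)) (fun i => x (k - 1 - i)) := by
  have hs : ∀ i < k, s(w (k - i), w (k - (i + 1))) = s(w (k - 1 - i), w (k - 1 - i + 1)) := by
    intro i hi
    rw [Sym2.eq_swap, show k - (i + 1) = k - 1 - i by omega, show k - 1 - i + 1 = k - i by omega]
  refine ⟨fun a ha b hb hab => ?_, fun i hi => ?_, fun i hi j hj a b a' b' hab hle hab' hle' => ?_⟩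
  · have := h.injOn (Set.mem_Iic.2 (by omega)) (Set.mem_Iic.2 (by omega)) hab
    simp only [Set.mem_Iic] at ha hb
    omega
  · have := (h.step (k - 1 - i) (by omega)).symm
    rwa [show k - 1 - i + 1 = k - i by omega, show k - 1 - i = k - (i + 1) by omega] at this
  · rw [hs i hi] at hab
    rw [hs j hj] at hab'
    exact h.lt_iff _ (by omega) _ (by omega) _ _ _ _ hab hle hab' hle'

theorem IsPowPath.lt_of_lower' {N k : ℕ} {w : ℕ → ℕ} {x : ℕ → ℤ} (h : IsPowPath N 1 1 1 0 k w x)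
    {i : ℕ} (hi : i + 2 < k) (hw : w (i + 2) < N) (hx : x (i + 1) < x (i + 2)) :
    x i < x (i + 2) := by
  have := h.reverse.lt_of_lower (i := k - 3 - i) (by omega)
  simp only [show k - (k - 3 - i + 1) = i + 2 by omega,
    show k - 1 - (k - 3 - i) = i + 2 by omega, show k - 1 - (k - 3 - i + 1) = i + 1 by omega,
    show k - 1 - (k - 3 - i + 2) = i by omega] at this
  exact this hw hx

theorem IsPowPath.lt_of_upper' {N k : ℕ} {w : ℕ → ℕ} {x : ℕ → ℤ} (h : IsPowPath N 1 1 1 0 k w x)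
    {i : ℕ} (hi : i + 2 < k) (hw : ¬ w (i + 2) < N) (hx : x (i + 2) < x (i + 1)) :
    x (i + 2) < x i := by
  have := h.reverse.lt_of_upper (i := k - 3 - i) (by omega)
  simp only [show k - (k - 3 - i + 1) = i + 2 by omega,
    show k - 1 - (k - 3 - i) = i + 2 by omega, show k - 1 - (k - 3 - i + 1) = i + 1 by omega,
    show k - 1 - (k - 3 - i + 2) = i by omega] at this
  exact this hw hx

/-- The orders by lower ends and the order by `a + b` together leave no pattern of four consecutive
edges that is not separated. -/
theorem separated_of_isPowPath {N k : ℕ} {w₁ w₂ w₃ w₄ w₅ : ℕ → ℕ} {x : ℕ → ℤ}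
    (h₁ : IsPowPath N 1 0 0 1 k w₁ x) (h₂ : IsPowPath N 1 0 0 (-1) k w₂ x)
    (h₃ : IsPowPath N (-1) 0 0 1 k w₃ x) (h₄ : IsPowPath N (-1) 0 0 (-1) k w₄ x)
    (h₅ : IsPowPath N 1 1 1 0 k w₅ x) (hx : Set.InjOn x (Set.Iio k)) {i : ℕ} (hi : i + 3 < k) :
    Separated (x i) (x (i + 1)) (x (i + 2)) (x (i + 3)) := by
  rcases separated_or_crossed h₁ h₂ h₃ h₄ hx hi with h | ⟨c₁, c₂, c₃⟩ | ⟨c₁, c₂, c₃⟩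
  · exact h
  · by_cases hw : w₅ (i + 2) < N
    · exact absurd (h₅.lt_of_lower (i := i + 1) (by omega) hw c₂) c₃.not_gt
    · exact absurd (h₅.lt_of_upper' (by omega) hw c₂) c₁.not_gt
  · by_cases hw : w₅ (i + 2) < N
    · exact absurd (h₅.lt_of_lower' (by omega) hw c₂) c₃.not_gt
    · exact absurd (h₅.lt_of_upper (i := i + 1) (by omega) hw c₂) c₁.not_gt

/-! ### Paths that are flipped at both ends -/

/-- In the order by lower ends, the edges with a given lower end form an interval. So if the first of
three consecutive edges lies between the other two in the order, then these do not share their lower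
end, and the common end of the first two is a lower end. -/
theorem IsPowPath.not_between {N k : ℕ} {w : ℕ → ℕ} {x : ℕ → ℤ} (h : IsPowPath N 1 0 0 1 k w x)
    {i : ℕ} (hi : i + 2 < k) (hx₁ : x (i + 1) < x i) (hx₂ : x i < x (i + 2)) :
    w (i + 1) < N := by
  by_contra hw
  have s₀ := h.step_up (i := i) (by omega) (by
    by_contra hw0
    exact hw (h.step_down (by omega) hw0).lt.1)
  have s₁ : PowStep N (w (i + 2)) (w (i + 1)) := h.step_down (i := i + 1) (by omega) hw
  have s₂ : PowStep N (w (i + 2)) (w (i + 3)) := h.step_up (i := i + 2) (by omega) s₁.lt.1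
  have l₀ := s₀.lt
  have l₁ := s₁.lt
  have l₂ := s₂.lt
  have e₁ := h.lt_iff (i + 1) (by omega) i (by omega) (w (i + 2)) (w (i + 1)) (w i) (w (i + 1))
    Sym2.eq_swap (by omega) rfl (by omega)
  have e₂ := h.lt_iff i (by omega) (i + 2) hi (w i) (w (i + 1)) (w (i + 2)) (w (i + 3))
    rfl (by omega) rfl (by omega)
  rw [e₁] at hx₁
  rw [e₂] at hx₂
  have hne : w i ≠ w (i + 2) := fun he => by
    have := h.injOn (Set.mem_Iic.2 (by omega)) (Set.mem_Iic.2 (by omega)) he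
    omega
  omega

theorem IsPowPath.not_between' {N k : ℕ} {w : ℕ → ℕ} {x : ℕ → ℤ} (h : IsPowPath N 1 0 0 1 k w x)
    {i : ℕ} (hi : i + 2 < k) (hx₁ : x i < x (i + 2)) (hx₂ : x (i + 2) < x (i + 1)) :
    w (i + 2) < N := by
  by_contra hw
  have s₂ : PowStep N (w (i + 3)) (w (i + 2)) := h.step_down (i := i + 2) (by omega) hw
  have s₁ : PowStep N (w (i + 1)) (w (i + 2)) := h.step_up (i := i + 1) (by omega) (by
    by_contra hw0
    exact hw (h.step_down (i := i + 1) (by omega) hw0).lt.1)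
  have s₀ : PowStep N (w (i + 1)) (w i) := h.step_down (i := i) (by omega) (by
    intro hw0
    exact (h.step_up (by omega) hw0).not_lt s₁.lt.1)
  have l₀ := s₀.lt
  have l₁ := s₁.lt
  have l₂ := s₂.lt
  have e₁ := h.lt_iff i (by omega) (i + 2) hi (w (i + 1)) (w i) (w (i + 3)) (w (i + 2))
    Sym2.eq_swap (by omega) Sym2.eq_swap (by omega)
  have e₂ := h.lt_iff (i + 2) hi (i + 1) (by omega) (w (i + 3)) (w (i + 2)) (w (i + 1)) (w (i + 2))
    Sym2.eq_swap (by omega) rfl (by omega)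
  rw [e₁] at hx₁
  rw [e₂] at hx₂
  have hne : w (i + 1) ≠ w (i + 3) := fun he => by
    have := h.injOn (Set.mem_Iic.2 (by omega)) (Set.mem_Iic.2 (by omega)) he
    omega
  omega

/-- The labels of a path cannot start like `213` and end like `132`: the order by lower ends forces
`w 1` and `w (k - 1)` to lie on the same side, while the order by `a + b` forces them to lie on
different sides. -/
theorem not_flipped_twice {N k : ℕ} {w₁ w₂ : ℕ → ℕ} {x : ℕ → ℤ}
    (h₁ : IsPowPath N 1 0 0 1 (k + 3) w₁ x) (h₂ : IsPowPath N 1 1 1 0 (k + 3) w₂ x)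
    (hx₁ : x 1 < x 0) (hx₂ : x 0 < x 2) (hx₃ : x k < x (k + 2)) (hx₄ : x (k + 2) < x (k + 1)) :
    False := by
  have a₁ := h₁.not_between (i := 0) (by omega) hx₁ hx₂
  have a₂ := h₁.not_between' (by omega) hx₃ hx₄
  have b₁ : ¬ w₂ 1 < N := fun hw => hx₂.not_gt (h₂.lt_of_lower (i := 0) (by omega) hw hx₁)
  have b₂ : w₂ (k + 2) < N := by
    by_contra hw
    exact hx₃.not_gt (h₂.lt_of_upper' (by omega) hw hx₄)
  rw [zero_add, h₁.lt_iff_even 1 (by omega)] at a₁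
  rw [h₁.lt_iff_even (k + 2) (by omega)] at a₂
  rw [h₂.lt_iff_even 1 (by omega)] at b₁
  rw [h₂.lt_iff_even (k + 2) (by omega)] at b₂
  have : ¬ Even 1 := by decide
  tauto

/-! ### Paths all of whose four consecutive edges are separated -/

theorem lt_of_separated {k : ℕ} {x : ℕ → ℤ} (h0 : x 0 < x 2)
    (hs : ∀ i, i + 3 < k → Separated (x i) (x (i + 1)) (x (i + 2)) (x (i + 3))) :
    (∀ i j, i + 2 ≤ j → j < k → x i < x j) ∧ ∀ i, 1 ≤ i → i + 2 < k → x i < x (i + 1) := by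
  -- consecutive windows share two labels, so all of them are separated in the same direction
  have hup : ∀ i, i + 3 < k →
      x i < x (i + 2) ∧ x i < x (i + 3) ∧ x (i + 1) < x (i + 2) ∧ x (i + 1) < x (i + 3) := by
    intro i
    induction i with
    | zero =>
      intro hi
      exact (hs 0 hi).resolve_right fun h => h.1.not_gt h0
    | succ i ih =>
      intro hi
      exact (hs (i + 1) hi).resolve_right fun h => h.1.not_gt (ih (by omega)).2.2.2
  have h2 : ∀ i, i + 2 < k → x i < x (i + 2) := by
    intro i hi
    rcases i with _ | i
    · exact h0
    · exact (hup i hi).2.2.2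
  refine ⟨fun i j => ?_, fun i h1 hi => ?_⟩
  · induction j using Nat.strong_induction_on with
    | _ j ih =>
      intro hij hj
      rcases Nat.lt_or_ge j (i + 4) with h | h
      · obtain rfl | rfl : j = i + 2 ∨ j = i + 3 := by omega
        · exact h2 i hj
        · exact (hup i hj).2.1
      · obtain ⟨j, rfl⟩ : ∃ j', j = j' + 2 := ⟨j - 2, by omega⟩
        exact (ih j (by omega) (by omega) (by omega)).trans (h2 j hj)
  · obtain ⟨i, rfl⟩ : ∃ i', i = i' + 1 := ⟨i - 1, by omega⟩
    exact (hup i hi).2.2.1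

theorem isPathLabeled_swap {V : Type*} {P : EdgeOrderedGraph V} {k : ℕ}
    (φ : SimpleGraph.pathGraph (k + 1) ≃g P.graph) {x : ℕ → ℤ}
    (hx : ∀ i j : Fin k, P.EdgeLT (pathEdge φ i) (pathEdge φ j) ↔ x i < x j) {a b : ℕ}
    (ha : a < k) (hb : b < k)
    (hmono : ∀ i, i + 1 < k → x (Equiv.swap a b i) < x (Equiv.swap a b (i + 1))) :
    P.IsPathLabeled (Equiv.swap (⟨a, ha⟩ : Fin k) ⟨b, hb⟩) := by
  refine ⟨φ, fun i j => ?_⟩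
  have hlt : ∀ i : Fin k, Equiv.swap a b (i : ℕ) < k := by
    intro i
    rw [Equiv.swap_apply_def]
    split_ifs <;> omega
  have := (strictMonoOn_Iio_of_lt_succ (f := fun i => x (Equiv.swap a b i)) hmono).lt_iff_lt
    (Set.mem_Iio.2 (hlt i)) (Set.mem_Iio.2 (hlt j))
  rw [hx, Fin.lt_def, val_swap, val_swap, ← this, Equiv.swap_apply_self, Equiv.swap_apply_self]

/-- The labels of a path, listed from an end with `x 0 < x (k - 1)`. -/
theorem exists_labels {V : Type*} {P : EdgeOrderedGraph V} {k : ℕ} (hk : 2 ≤ k)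
    (hP : P.IsPath k) :
    ∃ (φ : SimpleGraph.pathGraph (k + 1) ≃g P.graph) (x : ℕ → ℤ),
      (∀ i j : Fin k, P.EdgeLT (pathEdge φ i) (pathEdge φ j) ↔ x i < x j) ∧
      Set.InjOn x (Set.Iio k) ∧ x 0 < x (k - 1) := by
  obtain ⟨φ⟩ := hP
  have := Finite.of_equiv _ φ.toEquiv
  obtain ⟨r, hr⟩ := P.exists_isKey
  let x : ℕ → ℤ := fun i => if h : i < k then r (pathEdge φ ⟨i, h⟩) else 0
  have hx : ∀ i : Fin k, x i = r (pathEdge φ i) := fun i => dif_pos i.2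
  have hinj : Set.InjOn x (Set.Iio k) := by
    intro i hi j hj hij
    have h := hr.injOn (pathEdge φ ⟨i, hi⟩).2 (pathEdge φ ⟨j, hj⟩).2
      ((hx ⟨i, hi⟩).symm.trans (hij.trans (hx ⟨j, hj⟩)))
    exact congrArg Fin.val (pathEdge_injective φ (Subtype.ext h))
  have hlt : ∀ i j : Fin k, P.EdgeLT (pathEdge φ i) (pathEdge φ j) ↔ x i < x j := fun i j => by
    rw [hr, hx, hx]
  rcases lt_trichotomy (x 0) (x (k - 1)) with h | h | h
  · exact ⟨φ, x, hlt, hinj, h⟩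
  · have := hinj (Set.mem_Iio.2 (by omega)) (Set.mem_Iio.2 (by omega)) h
    omega
  · refine ⟨reverseIso φ, fun i => x (k - 1 - i), fun i j => ?_, fun i hi j hj hij => ?_, ?_⟩
    · rw [pathEdge_reverseIso, pathEdge_reverseIso, hlt, Fin.val_rev, Fin.val_rev,
        show k - (i + 1) = k - 1 - (i : ℕ) by omega, show k - (j + 1) = k - 1 - (j : ℕ) by omega]
    · have := hinj (Set.mem_Iio.2 (by omega)) (Set.mem_Iio.2 (by omega)) hij
      simp only [Set.mem_Iio] at hi hj
      omega
    · simpa using h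

/-- A path contained in `powGraph n` for each of the five orders is monotone or flipped. -/
theorem monotone_or_flipped_of_isPowPath {V : Type*} {P : EdgeOrderedGraph V} {k : ℕ} (hk : 2 ≤ k)
    (φ : SimpleGraph.pathGraph (k + 1) ≃g P.graph) {x : ℕ → ℤ}
    (hx : ∀ i j : Fin k, P.EdgeLT (pathEdge φ i) (pathEdge φ j) ↔ x i < x j)
    (hinj : Set.InjOn x (Set.Iio k)) (h0 : x 0 < x (k - 1)) {N : ℕ} {w₁ w₂ w₃ w₄ w₅ : ℕ → ℕ}
    (h₁ : IsPowPath N 1 0 0 1 k w₁ x) (h₂ : IsPowPath N 1 0 0 (-1) k w₂ x)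
    (h₃ : IsPowPath N (-1) 0 0 1 k w₃ x) (h₄ : IsPowPath N (-1) 0 0 (-1) k w₄ x)
    (h₅ : IsPowPath N 1 1 1 0 k w₅ x) : P.IsMonotonePath k ∨ P.IsFlippedPath k := by
  have hsep : ∀ i, i + 3 < k → Separated (x i) (x (i + 1)) (x (i + 2)) (x (i + 3)) :=
    fun i hi => separated_of_isPowPath h₁ h₂ h₃ h₄ h₅ hinj hi
  have hmono : (∀ i, i + 1 < k → x i < x (i + 1)) → P.IsMonotonePath k := fun hm =>
    ⟨1, Or.inl strictMono_id, φ, fun i j => by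
      rw [hx]
      exact (strictMonoOn_Iio_of_lt_succ hm).lt_iff_lt (Set.mem_Iio.2 i.2) (Set.mem_Iio.2 j.2)⟩
  rcases Nat.lt_or_ge k 3 with hk3 | hk3
  · obtain rfl : k = 2 := by omega
    exact Or.inl (hmono fun i hi => by
      obtain rfl : i = 0 := by omega
      exact h0)
  have hne : ∀ s t, s < k → t < k → s ≠ t → x s ≠ x t := fun s t hs ht hst he =>
    hst (hinj (Set.mem_Iio.2 hs) (Set.mem_Iio.2 ht) he)
  have h02 : x 0 < x 2 := by
    by_contra hcon
    have h20 := lt_of_le_of_ne (not_lt.1 hcon) (hne 2 0 (by omega) (by omega) (by omega))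
    have := (lt_of_separated (x := fun i => -x i) (neg_lt_neg h20) fun i hi => by
      have := hsep i hi
      simp only [Separated, neg_lt_neg_iff] at this ⊢
      omega).1 0 (k - 1) (by omega) (by omega)
    exact h0.not_gt (neg_lt_neg_iff.1 this)
  obtain ⟨hfar, hmid⟩ := lt_of_separated h02 hsep
  obtain ⟨k, rfl⟩ : ∃ k', k = k' + 3 := ⟨k - 3, by omega⟩
  rcases lt_or_gt_of_ne (hne 0 1 (by omega) (by omega) (by omega)) with hb | hb <;>
    rcases lt_or_gt_of_ne (hne (k + 1) (k + 2) (by omega) (by omega) (by omega)) with ht | ht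
  · refine Or.inl (hmono fun i hi => ?_)
    rcases Nat.eq_zero_or_pos i with rfl | hi0
    · exact hb
    · rcases Nat.lt_or_ge (i + 2) (k + 3) with hi2 | hi2
      · exact hmid i hi0 hi2
      · obtain rfl : i = k + 1 := by omega
        exact ht
  · refine Or.inr ⟨hk3, 1, Or.inl strictMono_id, Or.inr ?_⟩
    rw [mul_one]
    refine isPathLabeled_swap φ hx _ _ fun i hi => ?_
    simp only [show k + 3 - 2 = k + 1 by omega, show k + 3 - 1 = k + 2 by omega]
    rcases lt_trichotomy i k with h | rfl | h
    · rw [Equiv.swap_apply_of_ne_of_ne (by omega) (by omega),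
        Equiv.swap_apply_of_ne_of_ne (by omega) (by omega)]
      rcases Nat.eq_zero_or_pos i with rfl | hi0
      · exact hb
      · exact hmid i hi0 (by omega)
    · rw [Equiv.swap_apply_of_ne_of_ne (by omega) (by omega), Equiv.swap_apply_left]
      exact hfar _ _ (by omega) (by omega)
    · obtain rfl : i = k + 1 := by omega
      rw [Equiv.swap_apply_left, Equiv.swap_apply_right]
      exact ht
  · refine Or.inr ⟨hk3, 1, Or.inl strictMono_id, Or.inl ?_⟩
    rw [mul_one]
    refine isPathLabeled_swap φ hx _ _ fun i hi => ?_
    rcases Nat.lt_or_ge i 2 with h | h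
    · obtain rfl | rfl : i = 0 ∨ i = 1 := by omega
      · rw [Equiv.swap_apply_left, Equiv.swap_apply_right]
        exact hb
      · rw [Equiv.swap_apply_right, Equiv.swap_apply_of_ne_of_ne (by omega) (by omega)]
        exact h02
    · rw [Equiv.swap_apply_of_ne_of_ne (by omega) (by omega),
        Equiv.swap_apply_of_ne_of_ne (by omega) (by omega)]
      rcases Nat.lt_or_ge (i + 2) (k + 3) with hi2 | hi2
      · exact hmid i (by omega) hi2
      · obtain rfl : i = k + 1 := by omega
        exact ht
  · exact (not_flipped_twice h₁ h₅ hb h02 (hfar k (k + 2) (by omega) (by omega)) ht).elim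

theorem mul_log_le_extremalFunction {V : Type*} {P : EdgeOrderedGraph V} {k : ℕ} (hk : 2 ≤ k)
    (hP : P.IsPath k) (hne : P.graph.edgeSet.Nonempty)
    (h : ¬ (P.IsMonotonePath k ∨ P.IsFlippedPath k)) (n : ℕ) :
    n / 4 * Nat.log 2 n ≤ P.extremalFunction n := by
  by_contra hlt
  obtain ⟨φ, x, hx, hinj, h0⟩ := exists_labels hk hP
  have hcontains : ∀ {α β γ δ : ℤ}, α * δ - β * γ ≠ 0 → ∃ w, IsPowPath (n / 4) α β γ δ k w x := by
    intro α β γ δ hdet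
    refine exists_isPowPath φ hx hdet ?_
    by_contra havoid
    exact hlt ((le_ncard_edgeSet_powGraph n).trans
      (ncard_edgeSet_le_extremalFunction hne havoid))
  obtain ⟨w₁, h₁⟩ := hcontains (α := 1) (β := 0) (γ := 0) (δ := 1) (by norm_num)
  obtain ⟨w₂, h₂⟩ := hcontains (α := 1) (β := 0) (γ := 0) (δ := -1) (by norm_num)
  obtain ⟨w₃, h₃⟩ := hcontains (α := -1) (β := 0) (γ := 0) (δ := 1) (by norm_num)
  obtain ⟨w₄, h₄⟩ := hcontains (α := -1) (β := 0) (γ := 0) (δ := -1) (by norm_num)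
  obtain ⟨w₅, h₅⟩ := hcontains (α := 1) (β := 1) (γ := 1) (δ := 0) (by norm_num)
  exact h (monotone_or_flipped_of_isPowPath hk φ hx hinj h0 h₁ h₂ h₃ h₄ h₅)

theorem IsPath.edgeSet_nonempty {V : Type*} {P : EdgeOrderedGraph V} {k : ℕ} (hP : P.IsPath k)
    (hk : 0 < k) : P.graph.edgeSet.Nonempty := by
  obtain ⟨φ⟩ := hP
  exact ⟨_, (pathEdge φ ⟨0, hk⟩).2⟩

/-! ### Asymptotics -/

theorem mul_log_le_sixteen_mul {n : ℕ} (hn : 4 ≤ n) :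
    (n : ℝ) * Real.log n ≤ 16 * ((n / 4 * Nat.log 2 n : ℕ) : ℝ) := by
  have h1 : (n : ℝ) ≤ 8 * ((n / 4 : ℕ) : ℝ) := by
    exact_mod_cast (by omega : n ≤ 8 * (n / 4))
  have hn0 : (0 : ℝ) < n := by positivity
  have h2 : Real.log n ≤ 2 * (Nat.log 2 n : ℝ) := by
    have hpow : (n : ℝ) ≤ 2 ^ (Nat.log 2 n + 1) := by
      exact_mod_cast (Nat.lt_pow_succ_log_self (by omega : 1 < 2) n).le
    have hlog : (1 : ℝ) ≤ Nat.log 2 n := by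
      exact_mod_cast Nat.log_pos (by omega : 1 < 2) (by omega : 2 ≤ n)
    have h3 := Real.log_le_log hn0 hpow
    rw [Real.log_pow] at h3
    have h4 : Real.log 2 ≤ 1 := by
      have := Real.log_le_sub_one_of_pos (two_pos (α := ℝ))
      linarith
    push_cast at h3
    nlinarith
  calc (n : ℝ) * Real.log n ≤ (8 * ((n / 4 : ℕ) : ℝ)) * (2 * (Nat.log 2 n : ℝ)) :=
        mul_le_mul h1 h2 (Real.log_natCast_nonneg n) (by positivity)
    _ = 16 * ((n / 4 * Nat.log 2 n : ℕ) : ℝ) := by push_cast; ring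

end EdgeOrderedGraph

theorem mainTheorem2 {V : Type*} (P : EdgeOrderedGraph V) (k : ℕ) (hk : 2 ≤ k)
    (hP : P.IsPath k) :
    ((P.IsMonotonePath k ∨ P.IsFlippedPath k) →
      (fun n : ℕ => (P.extremalFunction n : ℝ)) =Θ[atTop] (fun n : ℕ => (n : ℝ))) ∧
    (¬ (P.IsMonotonePath k ∨ P.IsFlippedPath k) →
      (fun n : ℕ => (n : ℝ) * Real.log n) =O[atTop]
        (fun n : ℕ => (P.extremalFunction n : ℝ))) := by
  have hne := hP.edgeSet_nonempty (by omega)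
  refine ⟨fun h => ⟨?_, ?_⟩, fun h => ?_⟩
  · obtain ⟨C, hC⟩ := EdgeOrderedGraph.extremalFunction_le hk hne h
    refine IsBigO.of_bound C (Eventually.of_forall fun n => ?_)
    rw [Real.norm_natCast, Real.norm_natCast]
    exact_mod_cast hC n
  · refine IsBigO.of_bound 3 ((eventually_ge_atTop 2).mono fun n hn => ?_)
    rw [Real.norm_natCast, Real.norm_natCast]
    have := EdgeOrderedGraph.div_two_le_extremalFunction hk hP hne n
    exact_mod_cast (by omega : n ≤ 3 * P.extremalFunction n)
  · refine IsBigO.of_bound 16 ((eventually_ge_atTop 4).mono fun n hn => ?_)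
    rw [Real.norm_natCast,
      Real.norm_of_nonneg (mul_nonneg n.cast_nonneg (Real.log_natCast_nonneg n))]
    refine (EdgeOrderedGraph.mul_log_le_sixteen_mul hn).trans ?_
    have := EdgeOrderedGraph.mul_log_le_extremalFunction hk hP hne h n
    gcongr
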